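/- For $m,n\in\mathbb N=\{0,1,2,\dots\}$ let $\mathcal B_{mn}$ be the set of Brauer partitions, i.e. set partitions of $[m]\sqcup[n]'$ ($m$ upper and $n$ lower vertices) all of whose blocks have size $2$. For $\alpha\in\mathcal B_{mn}$, $\beta\in\mathcal B_{nk}$ the product $\alpha\beta\in\mathcal B_{mk}$ is obtained by stacking $\alpha$ on top of $\beta$, identifying the lower vertices of $\alpha$ with the upper vertices of $\beta$, and relating two outer vertices when they lie in the same connected component; $\alpha^*\in\mathcal B_{nm}$ is the reflection of $\alpha$; $\operatorname{rank}(\alpha)$ is the number of transversals of $\alpha$ (blocks with both an upper and a lower vertex); $\mathcal B_r=\mathcal B_{rr}$ is the Brauer monoid. Fix $\sigma\in\mathcal B_{nm}$ of rank $r$ (so $m\equiv n\equiv r \pmod 2$), and let $\mathcal B_{mn}^\sigma$ be the sandwich semigroup on the set $\mathcal B_{mn}$ with operation $\alpha\star\beta=\alpha\sigma\beta$. Write $\mathscr K^\sigma$ for Green's relation $\mathscr K\in\{\mathscr R,\mathscr L,\mathscr H,\mathscr D\}$ on $\mathcal B_{mn}^\sigma$ and $P^\sigma=\operatorname{Reg}(\mathcal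 B_{mn}^\sigma)$ for its set of (von Neumann) regular elements. Let $X_i\cup Y_i'$ ($1\le i\le r$) be the transversals of $\sigma$ in any order and $U_1,\dots,U_s$ its upper nontransversals, and let $\tau\in\mathcal B_{rn}$ be the Brauer partition with transversals $\{i\}\cup X_i'$ ($1\le i\le r$) and lower nontransversals $U_1',\dots,U_s'$. For $\alpha\in P^\sigma$ put $\overline\alpha=\tau\sigma\alpha\tau^*\in\mathcal B_r$. For $\mathscr K\in\{\mathscr R,\mathscr L,\mathscr H\}$ let $\widehat{\mathscr K}^\sigma$ be the equivalence on $P^\sigma$ relating $\alpha$ and $\beta$ exactly when $\overline\alpha\,\mathscr K\,\overline\beta$ in $\mathcal B_r$, and denote by $H_\alpha^\sigma$, $\widehat H_\alpha^\sigma$ and $H_{\overline\alpha}$ the $\mathscr H^\sigma$-class of $\alpha$, the $\widehat{\mathscr H}^\sigma$-class of $\alpha$ and the $\mathscr H$-class of $\overline\alpha$ in $\mathcal B_r$. Here $(-1)!!=1$, $\mathcal S_q$ is the symmetric group of degree $q$, and a $\rho\times\lambda$ rectangular group over a group $G$ is a semigroup isomorphic to $U\times V\times G$ with $U$ a left-zero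 semigroup of size $\rho$ and $V$ a right-zero semigroup of size $\lambda$. **Theorem.** Let $0\le q\le r$ with $q\equiv r\pmod 2$. The set $D_q^\sigma=\{\alpha\in P^\sigma:\operatorname{rank}(\alpha)=q\}$ is a $\mathscr D^\sigma$-class; it is a union of $\widehat{\mathscr R}^\sigma$-classes, of $\widehat{\mathscr L}^\sigma$-classes, of $\widehat{\mathscr H}^\sigma$-classes and of $\mathscr H^\sigma$-classes, and the following hold. 1. $D_q^\sigma$ contains $\binom rq(r-q-1)!!$ $\widehat{\mathscr R}^\sigma$-classes, each of which contains $\frac{(m+q-1)!!}{(r+q-1)!!}$ $\mathscr R^\sigma$-classes. 2. $D_q^\sigma$ contains $\binom rq(r-q-1)!!$ $\widehat{\mathscr L}^\sigma$-classes, each of which contains $\frac{(n+q-1)!!}{(r+q-1)!!}$ $\mathscr L^\sigma$-classes. 3. $D_q^\sigma$ contains $\binom rq^2\,(r-q-1)!!^2$ $\widehat{\mathscr H}^\sigma$-classes, each of which contains $\frac{(m+q-1)!!\,(n+q-1)!!}{(r+q-1)!!^2}$ $\mathscr H^\sigma$-classes. 4. Each $\mathscr H^\sigma$-class in $D_q^\sigma$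 has size $q!$, and group $\mathscr H^\sigma$-classes in $D_q^\sigma$ are isomorphic to $\mathcal S_q$. 5. For $\alpha\in D_q^\sigma$, every element of $H_{\overline\alpha}$ has rank $q$, and $H_\alpha^\sigma$ is a group if and only if $H_{\overline\alpha}$ is a group; in that case $\widehat H_\alpha^\sigma$ (the preimage of $H_{\overline\alpha}$ in $P^\sigma$) is a $\frac{(m+q-1)!!}{(r+q-1)!!}\times\frac{(n+q-1)!!}{(r+q-1)!!}$ rectangular group over $\mathcal S_q$. -/

import Mathlib

open scoped Nat

/-! ### Partition diagrams

A partition with upper vertices `A` and lower vertices `B` is a set partition (equivalently, an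
equivalence relation) of the disjoint union `A ⊕ B`. -/

namespace Diagram

variable {A B C D : Type}

/-- The vertices of `A ⊕ B` in the upper two rows of the product graph. -/
def upperRows : A ⊕ B → A ⊕ B ⊕ C := Sum.map id Sum.inl

/-- The vertices of `B ⊕ C` in the lower two rows of the product graph. -/
def lowerRows : B ⊕ C → A ⊕ B ⊕ C := Sum.inr

/-- The vertices of `A ⊕ C` as the top and bottom rows of the product graph. -/
def outerRows : A ⊕ C → A ⊕ B ⊕ C := Sum.map id Sum.inr

/-- Edges of the product graph `Π(α, β)` on three rows of vertices: edges of `α` between the upper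
two rows together with edges of `β` between the lower two rows. -/
def productEdge (α : Setoid (A ⊕ B)) (β : Setoid (B ⊕ C)) (x y : A ⊕ B ⊕ C) : Prop :=
  (∃ u v, α u v ∧ upperRows u = x ∧ upperRows v = y) ∨
  (∃ u v, β u v ∧ lowerRows u = x ∧ lowerRows v = y)

/-- Two vertices are related when they lie in the same connected component of `Π(α, β)`. -/
def productComponents (α : Setoid (A ⊕ B)) (β : Setoid (B ⊕ C)) : Setoid (A ⊕ B ⊕ C) :=
  Relation.EqvGen.setoid (productEdge α β)

/-- The product of partitions: outer vertices lie in the same block of the product when they lie in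
the same connected component of the product graph. -/
def comp (α : Setoid (A ⊕ B)) (β : Setoid (B ⊕ C)) : Setoid (A ⊕ C) :=
  (productComponents α β).comap outerRows

/-- The involution: reflection in a horizontal axis. -/
def star (α : Setoid (A ⊕ B)) : Setoid (B ⊕ A) := α.comap Sum.swap

/-- The transversals of a partition: blocks containing both upper and lower vertices. -/
def transversals (α : Setoid (A ⊕ B)) : Set (Set (A ⊕ B)) :=
  {X | X ∈ α.classes ∧ (∃ a, Sum.inl a ∈ X) ∧ (∃ b, Sum.inr b ∈ X)}

/-- The rank of a partition: the number of transversals. -/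
noncomputable def rank (α : Setoid (A ⊕ B)) : ℕ := (transversals α).ncard

/-- A Brauer partition: each block has size two. -/
def IsBrauer (α : Setoid (A ⊕ B)) : Prop := ∀ X ∈ α.classes, X.ncard = 2

/-! #### Associativity of the product -/

/-- A two-colouring of the vertices is compatible with a partition if it is constant on blocks. -/
def Resp (α : Setoid (A ⊕ B)) (a : A → Prop) (b : B → Prop) : Prop :=
  ∀ u v, α u v → Sum.elim a b u = Sum.elim a b v

theorem ext_resp {α β : Setoid (A ⊕ B)} (h : ∀ a b, Resp α a b ↔ Resp β a b) : α = β := by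
  have key : ∀ (α β : Setoid (A ⊕ B)), (∀ a b, Resp β a b → Resp α a b) →
      ∀ x y, α x y → β x y := by
    intro α β h x y hxy
    have h1 : Resp β (fun a => β x (Sum.inl a)) (fun b => β x (Sum.inr b)) := by
      intro u v huv
      have e : ∀ w, Sum.elim (fun a => β x (Sum.inl a)) (fun b => β x (Sum.inr b)) w = β x w := by
        rintro (w | w) <;> rfl
      rw [e, e]
      exact propext ⟨fun k => β.trans' k huv, fun k => β.trans' k (β.symm' huv)⟩
    have h2 := h _ _ h1 x y hxy
    have e : ∀ w, Sum.elim (fun a => β x (Sum.inl a)) (fun b => β x (Sum.inr b)) w = β x w := by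
      rintro (w | w) <;> rfl
    rw [e, e] at h2
    exact h2 ▸ β.refl' x
  ext x y
  exact ⟨key α β (fun a b => (h a b).2) x y, key β α (fun a b => (h a b).1) x y⟩

theorem resp_comp (α : Setoid (A ⊕ B)) (β : Setoid (B ⊕ C)) (a : A → Prop) (c : C → Prop) :
    Resp (comp α β) a c ↔ ∃ b, Resp α a b ∧ Resp β b c := by
  constructor
  · intro h
    let J := productComponents α β
    let f : A ⊕ B ⊕ C → Prop := fun z => ∃ u, J (outerRows u) z ∧ Sum.elim a c u
    have hf : ∀ x y, J x y → f x = f y := by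
      intro x y hxy
      apply propext
      exact ⟨fun ⟨u, h1, h2⟩ => ⟨u, J.trans' h1 hxy, h2⟩,
        fun ⟨u, h1, h2⟩ => ⟨u, J.trans' h1 (J.symm' hxy), h2⟩⟩
    have ho : ∀ u, f (outerRows u) = Sum.elim a c u := by
      intro u
      apply propext
      constructor
      · rintro ⟨v, h1, h2⟩
        exact (h v u h1) ▸ h2
      · intro hu
        exact ⟨u, J.refl' _, hu⟩
    have ha : ∀ x, f (Sum.inl x) = a x := fun x => ho (Sum.inl x)
    have hc : ∀ x, f (Sum.inr (Sum.inr x)) = c x := fun x => ho (Sum.inr x)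
    refine ⟨fun x => f (Sum.inr (Sum.inl x)), ?_, ?_⟩
    · intro u v huv
      have := hf (upperRows u) (upperRows v)
        (Relation.EqvGen.rel _ _ (Or.inl ⟨u, v, huv, rfl, rfl⟩))
      have e : ∀ w : A ⊕ B, Sum.elim a (fun x => f (Sum.inr (Sum.inl x))) w
          = f (upperRows w) := by
        rintro (w | w)
        · exact (ha w).symm
        · rfl
      rw [e, e, this]
    · intro u v huv
      have := hf (lowerRows u) (lowerRows v)
        (Relation.EqvGen.rel _ _ (Or.inr ⟨u, v, huv, rfl, rfl⟩))
      have e : ∀ w : B ⊕ C, Sum.elim (fun x => f (Sum.inr (Sum.inl x))) c w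
          = f (lowerRows w) := by
        rintro (w | w)
        · rfl
        · exact (hc w).symm
      rw [e, e, this]
  · rintro ⟨b, h1, h2⟩ u v huv
    have key : ∀ x y, productComponents α β x y →
        Sum.elim a (Sum.elim b c) x = Sum.elim a (Sum.elim b c) y := by
      intro x y hxy
      induction hxy with
      | rel x y h =>
        rcases h with ⟨u, v, h, rfl, rfl⟩ | ⟨u, v, h, rfl, rfl⟩
        · have := h1 u v h
          rcases u with u | u <;> rcases v with v | v <;> exact this
        · exact h2 u v h
      | refl x => rfl
      | symm x y _ ih => exact ih.symm
      | trans x y z _ _ ih1 ih2 => exact ih1.trans ih2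
    have := key _ _ huv
    rcases u with u | u <;> rcases v with v | v <;> exact this

theorem comp_assoc (α : Setoid (A ⊕ B)) (β : Setoid (B ⊕ C)) (γ : Setoid (C ⊕ D)) :
    comp (comp α β) γ = comp α (comp β γ) := by
  apply ext_resp
  intro a d
  simp only [resp_comp]
  constructor
  · rintro ⟨c, ⟨b, h1, h2⟩, h3⟩
    exact ⟨b, h1, c, h2, h3⟩
  · rintro ⟨b, h1, c, h2, h3⟩
    exact ⟨c, ⟨b, h1, h2⟩, h3⟩

/-! #### Brauer partitions are closed under the operations -/

theorem isBrauer_iff (α : Setoid (A ⊕ B)) :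
    IsBrauer α ↔ ∀ x, {y | α x y}.ncard = 2 := by
  constructor
  · intro h x
    have : {y | α x y} = {y | α y x} := by
      ext y; exact ⟨fun k => α.symm' k, fun k => α.symm' k⟩
    rw [this]
    exact h _ ⟨x, rfl⟩
  · rintro h X ⟨x, rfl⟩
    have : {y | α y x} = {y | α x y} := by
      ext y; exact ⟨fun k => α.symm' k, fun k => α.symm' k⟩
    rw [this]
    exact h x

/-- In a Brauer partition each vertex has a unique partner. -/
theorem IsBrauer.exists_partner {α : Setoid (A ⊕ B)} (h : IsBrauer α) :
    ∃ p : A ⊕ B → A ⊕ B, (∀ x, p x ≠ x) ∧ (∀ x, p (p x) = x) ∧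
      ∀ x y, α x y ↔ y = x ∨ y = p x := by
  have h1 : ∀ x, ∃ y, y ≠ x ∧ ∀ z, α x z ↔ z = x ∨ z = y := by
    intro x
    obtain ⟨u, v, huv, e⟩ := Set.ncard_eq_two.1 ((isBrauer_iff α).1 h x)
    have hx : x ∈ {y | α x y} := α.refl' x
    have e' : ∀ z, α x z ↔ z = u ∨ z = v := fun z => by
      have : z ∈ {y | α x y} ↔ z ∈ ({u, v} : Set (A ⊕ B)) := by rw [e]
      simpa using this
    rcases (e' x).1 hx with rfl | rfl
    · exact ⟨v, huv.symm, e'⟩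
    · exact ⟨u, huv, fun z => (e' z).trans or_comm⟩
  choose p hp1 hp2 using h1
  refine ⟨p, hp1, fun x => ?_, hp2⟩
  have h3 : α (p x) x := α.symm' ((hp2 x (p x)).2 (Or.inr rfl))
  rcases (hp2 (p x) x).1 h3 with h4 | h4
  · exact absurd h4.symm (hp1 x)
  · exact h4.symm

theorem IsBrauer.of_partner {α : Setoid (A ⊕ B)} (p : A ⊕ B → A ⊕ B) (h1 : ∀ x, p x ≠ x)
    (h2 : ∀ x y, α x y ↔ y = x ∨ y = p x) : IsBrauer α := by
  rw [isBrauer_iff]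
  intro x
  have : {y | α x y} = {x, p x} := by
    ext y; simpa using h2 x y
  rw [this, Set.ncard_pair (h1 x).symm]

theorem IsBrauer.star {α : Setoid (A ⊕ B)} (h : IsBrauer α) : IsBrauer (star α) := by
  obtain ⟨p, h1, -, h3⟩ := h.exists_partner
  refine IsBrauer.of_partner (fun x => (p x.swap).swap) ?_ ?_
  · intro x hx
    apply h1 x.swap
    have := congrArg Sum.swap hx
    simpa using this
  · intro x y
    have : Diagram.star α x y ↔ α x.swap y.swap := Iff.rfl
    rw [this, h3]
    constructor
    · rintro (h | h)
      · left; simpa using congrArg Sum.swap h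
      · right; rw [← h]; simp
    · rintro (rfl | rfl)
      · left; rfl
      · right; simp

/-- A finite set carrying a fixed-point-free involution has even cardinality. -/
theorem even_card_of_partner {V : Type} (s : Finset V) (g : V → V) (hg : ∀ x ∈ s, g x ∈ s)
    (h1 : ∀ x ∈ s, g x ≠ x) (h2 : ∀ x ∈ s, g (g x) = x) : Even s.card := by
  have : ∑ _x ∈ s, (1 : ZMod 2) = 0 :=
    Finset.sum_involution (fun x _ => g x) (fun _ _ => by decide) (fun x hx _ => h1 x hx)
      (fun x hx => hg x hx) (fun x hx => h2 x hx)
  rw [Finset.sum_const, nsmul_eq_mul, mul_one] at this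
  exact (ZMod.natCast_eq_zero_iff_even).1 this

/-- A finite connected graph whose vertices have degree at most `2`, and at most `1` on `s`, meets
`s` in at most two vertices. -/
theorem card_le_two_of_degree {K : Type} [Fintype K] [DecidableEq K] (G : SimpleGraph K)
    [DecidableRel G.Adj] (hG : G.Connected) (s : Finset K)
    (hd : ∀ v, G.degree v ≤ if v ∈ s then 1 else 2) : s.card ≤ 2 := by
  have h1 := hG.card_vert_le_card_edgeSet_add_one
  rw [Nat.card_eq_fintype_card, Nat.card_eq_fintype_card, ← SimpleGraph.edgeFinset_card] at h1
  have h2 := G.sum_degrees_eq_twice_card_edges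
  have h3 : ∑ v, G.degree v ≤ ∑ v : K, (if v ∈ s then 1 else 2) :=
    Finset.sum_le_sum fun v _ => hd v
  have h4 : ∑ v : K, (if v ∈ s then 1 else 2) + s.card = 2 * Fintype.card K := by
    have : s.card = ∑ v : K, (if v ∈ s then 1 else 0) := by simp
    rw [this, ← Finset.sum_add_distrib]
    have : ∀ v : K, ((if v ∈ s then 1 else 2) + (if v ∈ s then 1 else 0) : ℕ) = 2 := by
      intro v; split_ifs <;> rfl
    simp [this, mul_comm]
  omega

theorem upperRows_injective : Function.Injective (upperRows : A ⊕ B → A ⊕ B ⊕ C) := by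
  rintro (x | x) (y | y) h <;> simp_all [upperRows]

theorem outerRows_injective : Function.Injective (outerRows : A ⊕ C → A ⊕ B ⊕ C) := by
  rintro (x | x) (y | y) h <;> simp_all [outerRows]

theorem IsBrauer.comp [Finite A] [Finite B] [Finite C] {α : Setoid (A ⊕ B)} {β : Setoid (B ⊕ C)}
    (hα : IsBrauer α) (hβ : IsBrauer β) : IsBrauer (comp α β) := by
  classical
  have := Fintype.ofFinite A
  have := Fintype.ofFinite B
  have := Fintype.ofFinite C
  obtain ⟨p, hp1, hp2, hp3⟩ := hα.exists_partner
  obtain ⟨r, hr1, hr2, hr3⟩ := hβ.exists_partner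
  rw [isBrauer_iff]
  intro x
  set J := productComponents α β with hJ
  have hJp : ∀ u, J (upperRows u) (upperRows (p u)) := fun u =>
    Relation.EqvGen.rel _ _ (Or.inl ⟨u, p u, (hp3 _ _).2 (Or.inr rfl), rfl, rfl⟩)
  have hJr : ∀ u, J (lowerRows u) (lowerRows (r u)) := fun u =>
    Relation.EqvGen.rel _ _ (Or.inr ⟨u, r u, (hr3 _ _).2 (Or.inr rfl), rfl, rfl⟩)
  -- the outer vertices, the top two rows and the bottom two rows of the component of `x`
  let O : Finset (A ⊕ C) := Finset.univ.filter fun y => J (outerRows x) (outerRows y)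
  let U : Finset (A ⊕ B) := Finset.univ.filter fun y => J (outerRows x) (upperRows y)
  let L : Finset (B ⊕ C) := Finset.univ.filter fun y => J (outerRows x) (lowerRows y)
  have hO : {y | Diagram.comp α β x y} = (O : Set (A ⊕ C)) := by
    ext y; simp only [O, Finset.coe_filter, Finset.mem_univ, true_and]; rfl
  rw [hO, Set.ncard_coe_finset]
  have hU : Even U.card := by
    refine even_card_of_partner U p ?_ (fun x _ => hp1 x) (fun x _ => hp2 x)
    intro u hu
    simp only [U, Finset.mem_filter, Finset.mem_univ, true_and] at hu ⊢
    exact J.trans' hu (hJp u)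
  have hL : Even L.card := by
    refine even_card_of_partner L r ?_ (fun x _ => hr1 x) (fun x _ => hr2 x)
    intro u hu
    simp only [L, Finset.mem_filter, Finset.mem_univ, true_and] at hu ⊢
    exact J.trans' hu (hJr u)
  have hsum : ∀ {X Y : Type} [Fintype X] [Fintype Y] (P : X ⊕ Y → Prop),
      (Finset.univ.filter P).card =
        (Finset.univ.filter fun a => P (Sum.inl a)).card +
        (Finset.univ.filter fun b => P (Sum.inr b)).card := by
    intro X Y _ _ P
    simp only [Finset.card_filter, Fintype.sum_sum_type]
  have hpos : 0 < O.card := Finset.card_pos.2 ⟨x, by simp [O]⟩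
  have heven : Even O.card := by
    have e1 := hsum fun y : A ⊕ C => J (outerRows x) (outerRows y)
    have e2 := hsum fun y : A ⊕ B => J (outerRows x) (upperRows y)
    have e3 := hsum fun y : B ⊕ C => J (outerRows x) (lowerRows y)
    change O.card = (Finset.univ.filter fun a : A => J (outerRows x) (Sum.inl a)).card +
      (Finset.univ.filter fun c : C => J (outerRows x) (Sum.inr (Sum.inr c))).card at e1
    change U.card = (Finset.univ.filter fun a : A => J (outerRows x) (Sum.inl a)).card +
      (Finset.univ.filter fun c : B => J (outerRows x) (Sum.inr (Sum.inl c))).card at e2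
    change L.card = (Finset.univ.filter fun a : B => J (outerRows x) (Sum.inr (Sum.inl a))).card +
      (Finset.univ.filter fun c : C => J (outerRows x) (Sum.inr (Sum.inr c))).card at e3
    rw [Nat.even_iff] at *
    omega
  have hle : O.card ≤ 2 := by
    let K : Type := {v : A ⊕ B ⊕ C // J (outerRows x) v}
    let G : SimpleGraph K := SimpleGraph.fromRel fun u v => productEdge α β u.1 v.1
    have hreach : ∀ u v, J u v → ∀ (hu : J (outerRows x) u) (hv : J (outerRows x) v),
        G.Reachable ⟨u, hu⟩ ⟨v, hv⟩ := by
      intro u v huv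
      induction huv with
      | rel u v h =>
        intro hu hv
        by_cases e : u = v
        · subst e; exact SimpleGraph.Reachable.refl _
        · apply SimpleGraph.Adj.reachable
          rw [SimpleGraph.fromRel_adj]
          exact ⟨fun h' => e (congrArg Subtype.val h'), Or.inl h⟩
      | refl u => intro _ _; exact SimpleGraph.Reachable.refl _
      | symm u v _ ih => intro hu hv; exact (ih hv hu).symm
      | trans u v w h1 h2 ih1 ih2 =>
        intro hu hw
        have hv : J (outerRows x) v := J.trans' hu h1
        exact (ih1 hu hv).trans (ih2 hv hw)
    have hG : G.Connected := by
      rw [SimpleGraph.connected_iff]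
      exact ⟨fun u v => hreach u.1 v.1 (J.trans' (J.symm' u.2) v.2) u.2 v.2,
        ⟨⟨outerRows x, J.refl' _⟩⟩⟩
    let s : Finset K := Finset.univ.filter fun v => ∃ y, outerRows y = v.1
    have hOs : O.card = s.card := by
      have : O.map ⟨outerRows, outerRows_injective⟩ = s.map ⟨Subtype.val, Subtype.val_injective⟩ := by
        ext v
        simp only [O, s, Finset.mem_map, Finset.mem_filter, Finset.mem_univ, true_and,
          Function.Embedding.coeFn_mk]
        constructor
        · rintro ⟨y, hy, rfl⟩
          exact ⟨⟨_, hy⟩, ⟨y, rfl⟩, rfl⟩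
        · rintro ⟨w, ⟨y, hy⟩, rfl⟩
          exact ⟨y, hy ▸ w.2, hy⟩
      simpa using congrArg Finset.card this
    rw [hOs]
    refine card_le_two_of_degree G hG s fun v => ?_
    have hadj : ∀ w, G.Adj v w → w.1 ≠ v.1 ∧
        ((∃ u, upperRows u = v.1 ∧ w.1 = upperRows (p u)) ∨
          ∃ u, lowerRows u = v.1 ∧ w.1 = lowerRows (r u)) := by
      intro w hw
      rw [SimpleGraph.fromRel_adj] at hw
      have hne : w.1 ≠ v.1 := fun h' => hw.1 (Subtype.ext h'.symm)
      refine ⟨hne, ?_⟩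
      have aux : ∀ a b : A ⊕ B, α a b → upperRows a = v.1 → upperRows b = w.1 →
          ∃ u, upperRows u = v.1 ∧ w.1 = upperRows (p u) := by
        intro a b h ha hb
        rcases (hp3 _ _).1 h with rfl | rfl
        · exact absurd (hb.symm.trans ha) hne
        · exact ⟨a, ha, hb.symm⟩
      have aux' : ∀ a b : B ⊕ C, β a b → lowerRows a = v.1 → lowerRows b = w.1 →
          ∃ u, lowerRows u = v.1 ∧ w.1 = lowerRows (r u) := by
        intro a b h ha hb
        rcases (hr3 _ _).1 h with rfl | rfl
        · exact absurd (hb.symm.trans ha) hne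
        · exact ⟨a, ha, hb.symm⟩
      rcases hw.2 with (⟨a, b, h, ha, hb⟩ | ⟨a, b, h, ha, hb⟩) |
        (⟨a, b, h, ha, hb⟩ | ⟨a, b, h, ha, hb⟩)
      · exact Or.inl (aux a b h ha hb)
      · exact Or.inr (aux' a b h ha hb)
      · exact Or.inl (aux b a (α.symm' h) hb ha)
      · exact Or.inr (aux' b a (β.symm' h) hb ha)
    have hcard : ∀ t : Finset (A ⊕ B ⊕ C), (∀ w, G.Adj v w → w.1 ∈ t) → G.degree v ≤ t.card := by
      intro t ht
      rw [← SimpleGraph.card_neighborFinset_eq_degree,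
        ← Finset.card_map ⟨Subtype.val, Subtype.val_injective⟩]
      apply Finset.card_le_card
      intro w hw
      simp only [Finset.mem_map, SimpleGraph.mem_neighborFinset, Function.Embedding.coeFn_mk] at hw
      obtain ⟨w', h1, rfl⟩ := hw
      exact ht w' h1
    obtain ⟨v, hv⟩ := v
    rcases v with a | b | c
    · have : (⟨Sum.inl a, hv⟩ : K) ∈ s := by
        simp only [s, Finset.mem_filter, Finset.mem_univ, true_and]; exact ⟨Sum.inl a, rfl⟩
      rw [if_pos this]
      refine hcard {upperRows (p (Sum.inl a))} fun w hw => ?_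
      rcases (hadj w hw).2 with ⟨u, h1, h2⟩ | ⟨u, h1, h2⟩
      · have : u = Sum.inl a := upperRows_injective (C := C) h1
        subst this
        simp [h2]
      · simp [lowerRows] at h1
    · refine le_trans (hcard {upperRows (p (Sum.inr b)), lowerRows (r (Sum.inl b))}
        fun w hw => ?_) ?_
      · rcases (hadj w hw).2 with ⟨u, h1, h2⟩ | ⟨u, h1, h2⟩
        · have : u = Sum.inr b := upperRows_injective (C := C) h1
          subst this
          simp [h2]
        · have : u = Sum.inl b := Sum.inr_injective h1
          subst this
          simp [h2]
      · have : (⟨Sum.inr (Sum.inl b), hv⟩ : K) ∉ s := by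
          simp only [s, Finset.mem_filter, Finset.mem_univ, true_and]
          rintro ⟨(y | y), hy⟩ <;> simp [outerRows] at hy
        rw [if_neg this]
        exact Finset.card_le_two
    · have : (⟨Sum.inr (Sum.inr c), hv⟩ : K) ∈ s := by
        simp only [s, Finset.mem_filter, Finset.mem_univ, true_and]; exact ⟨Sum.inr c, rfl⟩
      rw [if_pos this]
      refine hcard {lowerRows (r (Sum.inr c))} fun w hw => ?_
      rcases (hadj w hw).2 with ⟨u, h1, h2⟩ | ⟨u, h1, h2⟩
      · rcases u with u | u <;> simp [upperRows] at h1
      · have : u = Sum.inr c := Sum.inr_injective h1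
        subst this
        simp [h2]
  obtain ⟨k, hk⟩ := heven
  omega

/-! #### The partition `τ` associated with an enumeration of the transversals -/

/-- Let `X i ∪ (Y i)'` (for `i : R`) be an enumeration `e` of the transversals of `σ`, and `U j` its
upper nontransversals. This is the partition with transversals `{i} ∪ (X i)'` and lower
nontransversals `(U j)'` (and no other blocks): the vertex `i` is labelled by the `i`-th
transversal, a lower vertex `a'` by the block of `σ` containing the upper vertex `a`, and two
vertices lie in the same block when they have the same label. -/
def tau {R : Type} (σ : Setoid (A ⊕ B)) (e : R ≃ transversals σ) : Setoid (R ⊕ A) :=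
  Setoid.ker (Sum.elim (fun i => (e i : Set (A ⊕ B))) (fun a => {y | σ y (Sum.inl a)}))

theorem IsBrauer.tau {R : Type} {σ : Setoid (A ⊕ B)} (h : IsBrauer σ)
    (e : R ≃ transversals σ) : IsBrauer (tau σ e) := by
  obtain ⟨p, hp1, hp2, hp3⟩ := h.exists_partner
  have hll : ∀ i j, Diagram.tau σ e (Sum.inl i) (Sum.inl j) ↔ i = j := by
    intro i j
    change (e i : Set (A ⊕ B)) = e j ↔ i = j
    rw [Subtype.val_inj, e.apply_eq_iff_eq]
  have hlr : ∀ i a, Diagram.tau σ e (Sum.inl i) (Sum.inr a) ↔ Sum.inl a ∈ (e i : Set (A ⊕ B)) := by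
    intro i a
    change (e i : Set (A ⊕ B)) = {y | σ y (Sum.inl a)} ↔ _
    obtain ⟨⟨z, hz⟩, -, -⟩ := (e i).2
    rw [hz]
    constructor
    · intro h'
      rw [h']
      exact σ.refl' _
    · intro h'
      ext y
      exact ⟨fun k => σ.trans' k (σ.symm' h'), fun k => σ.trans' k h'⟩
  have hrr : ∀ a b, Diagram.tau σ e (Sum.inr a) (Sum.inr b) ↔ σ (Sum.inl a) (Sum.inl b) := by
    intro a b
    change {y | σ y (Sum.inl a)} = {y | σ y (Sum.inl b)} ↔ _
    constructor
    · intro h'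
      have : (Sum.inl a : A ⊕ B) ∈ {y | σ y (Sum.inl a)} := σ.refl' _
      rw [h'] at this
      exact this
    · intro h'
      ext y
      exact ⟨fun k => σ.trans' k h', fun k => σ.trans' k (σ.symm' h')⟩
  have key : ∀ x, ∃ y, y ≠ x ∧ ∀ z, Diagram.tau σ e x z ↔ z = x ∨ z = y := by
    rintro (i | a)
    · obtain ⟨⟨w, hw⟩, ⟨a, ha⟩, ⟨b, hb⟩⟩ := (e i).2
      have hi : ∀ y, y ∈ (e i : Set (A ⊕ B)) ↔ σ (Sum.inl a) y := by
        intro y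
        rw [hw] at ha ⊢
        exact ⟨fun k => σ.trans' ha (σ.symm' k), fun k => σ.trans' (σ.symm' k) ha⟩
      have hpa : p (Sum.inl a) = Sum.inr b := by
        rcases (hp3 _ _).1 ((hi _).1 hb) with h' | h'
        · cases h'
        · exact h'.symm
      refine ⟨Sum.inr a, by simp, ?_⟩
      rintro (j | c)
      · rw [hll]
        simp [eq_comm]
      · rw [hlr, hi, hp3, hpa]
        simp
    · rcases hpa : p (Sum.inl a) with a' | b
      · refine ⟨Sum.inr a', ?_, ?_⟩
        · intro h'
          apply hp1 (Sum.inl a)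
          rw [hpa, Sum.inr_injective h']
        · rintro (j | c)
          · have : ¬ Diagram.tau σ e (Sum.inr a) (Sum.inl j) := by
              intro h'
              have h2 := (hlr j a).1 ((Diagram.tau σ e).symm' h')
              obtain ⟨⟨w, hw⟩, -, ⟨b, hb⟩⟩ := (e j).2
              rw [hw] at h2 hb
              rcases (hp3 _ _).1 (σ.trans' h2 (σ.symm' hb)) with h3 | h3
              · cases h3
              · rw [hpa] at h3
                cases h3
            simp [this]
          · rw [hrr, hp3, hpa]
            simp
      · have hX : {y | σ y (Sum.inl a)} ∈ transversals σ :=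
          ⟨⟨_, rfl⟩, ⟨a, σ.refl' _⟩, ⟨b, σ.symm' ((hp3 _ _).2 (Or.inr hpa.symm))⟩⟩
        refine ⟨Sum.inl (e.symm ⟨_, hX⟩), by simp, ?_⟩
        rintro (j | c)
        · rw [Setoid.comm', or_iff_right (by simp)]
          have : Diagram.tau σ e (Sum.inl (e.symm ⟨_, hX⟩)) (Sum.inr a) := by
            rw [hlr]
            simp
          constructor
          · intro h'
            have := (Diagram.tau σ e).trans' h' ((Diagram.tau σ e).symm' this)
            rw [hll] at this
            rw [this]
          · intro h'
            rw [Sum.inl_injective h']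
            exact this
        · rw [hrr, hp3, hpa]
          simp
  choose f hf1 hf2 using key
  exact IsBrauer.of_partner f hf1 hf2

end Diagram

/-! ### Semigroups: Green's relations, regularity, groups and rectangular groups -/

section Semigroups

variable (S : Type) [Semigroup S]

/-- Green's `R` relation: `x` and `y` generate the same principal right ideal, that is,
`x ∈ y S¹` and `y ∈ x S¹`. -/
def greenR : Setoid S where
  r x y := (x = y ∨ ∃ u, x = y * u) ∧ (y = x ∨ ∃ v, y = x * v)
  iseqv := by
    have tr : ∀ {x y z : S}, (x = y ∨ ∃ u, x = y * u) → (y = z ∨ ∃ u, y = z * u) →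
        (x = z ∨ ∃ u, x = z * u) := by
      rintro x y z (rfl | ⟨u, rfl⟩) (rfl | ⟨v, rfl⟩)
      · exact Or.inl rfl
      · exact Or.inr ⟨v, rfl⟩
      · exact Or.inr ⟨u, rfl⟩
      · exact Or.inr ⟨v * u, mul_assoc _ _ _⟩
    exact ⟨fun _ => ⟨Or.inl rfl, Or.inl rfl⟩, fun h => ⟨h.2, h.1⟩,
      fun h k => ⟨tr h.1 k.1, tr k.2 h.2⟩⟩

/-- Green's `L` relation: `x` and `y` generate the same principal left ideal, that is,
`x ∈ S¹ y` and `y ∈ S¹ x`. -/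
def greenL : Setoid S where
  r x y := (x = y ∨ ∃ u, x = u * y) ∧ (y = x ∨ ∃ v, y = v * x)
  iseqv := by
    have tr : ∀ {x y z : S}, (x = y ∨ ∃ u, x = u * y) → (y = z ∨ ∃ u, y = u * z) →
        (x = z ∨ ∃ u, x = u * z) := by
      rintro x y z (rfl | ⟨u, rfl⟩) (rfl | ⟨v, rfl⟩)
      · exact Or.inl rfl
      · exact Or.inr ⟨v, rfl⟩
      · exact Or.inr ⟨u, rfl⟩
      · exact Or.inr ⟨u * v, (mul_assoc _ _ _).symm⟩
    exact ⟨fun _ => ⟨Or.inl rfl, Or.inl rfl⟩, fun h => ⟨h.2, h.1⟩,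
      fun h k => ⟨tr h.1 k.1, tr k.2 h.2⟩⟩

/-- Green's `H` relation: the intersection of `R` and `L`. -/
def greenH : Setoid S := greenR S ⊓ greenL S

/-- Green's `D` relation: the join of `R` and `L` in the lattice of equivalences. -/
def greenD : Setoid S := greenR S ⊔ greenL S

/-- The set `Reg(S)` of (von Neumann) regular elements of `S`. -/
def regularElements : Set S := {x | ∃ a, x = x * a * x}

variable {S}

/-- The class of `x` under an equivalence. -/
def classOf {X : Type} (K : Setoid X) (x : X) : Set X := {y | K x y}

/-- The subset `X` of the semigroup `S` is a group under the operation of `S`. -/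
def IsGroupSubset (X : Set S) : Prop :=
  (∀ x ∈ X, ∀ y ∈ X, x * y ∈ X) ∧
    ∃ e ∈ X, (∀ x ∈ X, e * x = x ∧ x * e = x) ∧ ∀ x ∈ X, ∃ y ∈ X, x * y = e ∧ y * x = e

/-- The subset `X` of the semigroup `S` is a subsemigroup isomorphic to `T`. -/
def IsSubsetIsomorphicTo (X : Set S) (T : Type) [Mul T] : Prop :=
  ∃ f : T →ₙ* S, Function.Injective f ∧ Set.range f = X

end Semigroups

/-- A left-zero semigroup of size `ρ`. -/
structure LeftZero (ρ : ℕ) where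
  /-- the underlying point -/
  val : Fin ρ

/-- A right-zero semigroup of size `l`. -/
structure RightZero (l : ℕ) where
  /-- the underlying point -/
  val : Fin l

instance (ρ : ℕ) : Semigroup (LeftZero ρ) where
  mul u _ := u
  mul_assoc _ _ _ := rfl

instance (l : ℕ) : Semigroup (RightZero l) where
  mul _ v := v
  mul_assoc _ _ _ := rfl

/-- The subset `X` of `S` is a `ρ × l` rectangular group over `G`: a subsemigroup isomorphic to the
direct product of a `ρ × l` rectangular band with `G`. -/
def IsRectangularGroup {S : Type} [Semigroup S] (X : Set S) (ρ l : ℕ) (G : Type) [Group G] : Prop :=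
  IsSubsetIsomorphicTo X ((LeftZero ρ × RightZero l) × G)

/-! ### The Brauer category and its sandwich semigroups -/

/-- The set `B_{mn}` of Brauer partitions with `m` upper and `n` lower vertices. -/
def Brauer (m n : ℕ) : Type := {α : Setoid (Fin m ⊕ Fin n) // Diagram.IsBrauer α}

namespace Brauer

variable {k m n r : ℕ}

/-- The product in the Brauer category. -/
def comp (α : Brauer m n) (β : Brauer n k) : Brauer m k :=
  ⟨Diagram.comp α.1 β.1, α.2.comp β.2⟩

theorem comp_assoc {l : ℕ} (α : Brauer k l) (β : Brauer l m) (γ : Brauer m n) :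
    (α.comp β).comp γ = α.comp (β.comp γ) :=
  Subtype.ext (Diagram.comp_assoc α.1 β.1 γ.1)

/-- The involution of the Brauer category. -/
def star (α : Brauer m n) : Brauer n m := ⟨Diagram.star α.1, α.2.star⟩

/-- The number of transversals. -/
noncomputable def rank (α : Brauer m n) : ℕ := Diagram.rank α.1

/-- The Brauer partition `τ` attached to an enumeration of the transversals of `σ`. -/
def tau (σ : Brauer n m) (e : Fin r ≃ Diagram.transversals σ.1) : Brauer r n :=
  ⟨Diagram.tau σ.1 e, σ.2.tau e⟩

/-- The Brauer monoid `B_r`, as a semigroup. -/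
instance : Semigroup (Brauer r r) where
  mul := comp
  mul_assoc := comp_assoc

end Brauer

/-- The underlying set `B_{mn}` of the sandwich semigroup with sandwich element `σ ∈ B_{nm}`. -/
def Sandwich {m n : ℕ} (_σ : Brauer n m) : Type := Brauer m n

namespace Sandwich

variable {m n r : ℕ} {σ : Brauer n m}

theorem sandwich_assoc (σ : Brauer n m) (α β γ : Brauer m n) :
    (((α.comp σ).comp β).comp σ).comp γ = (α.comp σ).comp ((β.comp σ).comp γ) := by
  simp only [Brauer.comp_assoc]

/-- The sandwich operation `α ⋆ β = α σ β`. -/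
instance : Semigroup (Sandwich σ) where
  mul α β := Brauer.comp (Brauer.comp α σ) β
  mul_assoc := sandwich_assoc σ

/-- The number of transversals of an element of the sandwich semigroup. -/
noncomputable def rank (α : Sandwich σ) : ℕ := Brauer.rank (α : Brauer m n)

/-- The set `D_q^σ` of regular elements of rank `q`. -/
def D (σ : Brauer n m) (q : ℕ) : Set (Sandwich σ) :=
  {α | α ∈ regularElements (Sandwich σ) ∧ α.rank = q}

/-- The map `α ↦ τ σ α τ*` (used on the regular elements). -/
def bar (e : Fin r ≃ Diagram.transversals σ.1) (α : Sandwich σ) : Brauer r r :=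
  (((σ.tau e).comp σ).comp α).comp (σ.tau e).star

/-- For an equivalence `K` on `B_r`, the class of `α` under the relation on `Reg(B_{mn}^σ)` relating
`α` and `β` when their images in `B_r` are `K`-related. -/
def hatClass (e : Fin r ≃ Diagram.transversals σ.1) (K : Setoid (Brauer r r)) (α : Sandwich σ) :
    Set (Sandwich σ) :=
  {β | β ∈ regularElements (Sandwich σ) ∧ K (bar e α) (bar e β)}

/-- The set of all classes of the relation on `Reg(B_{mn}^σ)` induced by `K`. -/
def hatClasses (e : Fin r ≃ Diagram.transversals σ.1) (K : Setoid (Brauer r r)) :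
    Set (Set (Sandwich σ)) :=
  {X | ∃ α ∈ regularElements (Sandwich σ), X = hatClass e K α}

end Sandwich

/-- The number `(k - 1)!!`, used for even `k` only, with `(-1)!! = 1` when `k = 0`. -/
def predDoubleFactorial (k : ℕ) : ℕ := (k - 1)‼

/-! A partition is determined by its compatible two-colourings (`ext_resp`), and products and
reflections of partitions become composites and converses of relations between colourings
(`resp_comp`, `resp_star`). Identities between diagrams are proved in this relational form.

The coordinates come from frames, the partitions X in B_{mq} with X* X = 1, equivalently of rank q
(`isFrame_iff`). Every partition of rank q is X Y* with X and Y frames (`exists_frames`), uniquely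
up to (X, Y) ↦ (Xπ, Yπ) with π in S_q (`comp_star_eq_iff`). In the sandwich semigroup X Y* is
regular exactly when σX and σ*Y are still frames (`mem_D_iff`). On such elements the R-class is the
orbit X S_q, the L-class is the orbit Y S_q, and the H-class is X S_q Y*, of size q!. The product is
X (Y* σ X') Y'*, so the H-class is a group exactly when Y* σ X is a permutation.

The partition τ satisfies τ τ* = 1 and τ* τ = σ σ*. Hence bar sends X Y* to (τσX)(τY)*, again a
product of frames, and (τY)*(τσX) = Y* σ X, so bar preserves and reflects group H-classes. The
Brauer monoid is the sandwich semigroup with σ = 1, so the same description applies to the images.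
The hat classes in D_q therefore correspond to S_q-orbits of frames in B_{rq}, of which there are
binom(r, q)(r-q-1)!! (`card_isFrame`). Inside one hat class the R-classes correspond to a fibre of X
↦ τσX, and the L-classes to a fibre of Y ↦ τY.

The size of a fibre is found on all of B_{mq}, not only on frames: every relabelling of the r + q
outer vertices lifts to one of the m + q vertices (`exists_relabel_comp`), and relabellings act
transitively. So all fibres have the same size, the quotient of (m+q-1)!! by (r+q-1)!!
(`card_fibre`). Finally Y'* σ X' is the same permutation g for all X', Y' in the two fibres, and
shifting by g⁻¹ turns the hat H-class of a group H-class into a direct product. -/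

namespace Diagram

/-! ### Identity, reflection and rank through two-colourings. -/

variable {A B C D : Type}

/-- The identity partition, with blocks `{a, a'}`. -/
def one (A : Type) : Setoid (A ⊕ A) := Setoid.ker (Sum.elim id id)

theorem resp_one (a b : A → Prop) : Resp (one A) a b ↔ a = b := by
  constructor
  · intro h
    funext x
    exact h (Sum.inl x) (Sum.inr x) rfl
  · rintro rfl (u | u) (v | v) h <;> exact congrArg a h

theorem one_comp (α : Setoid (A ⊕ B)) : comp (one A) α = α := by
  apply ext_resp
  intro a b
  simp [resp_comp, resp_one]

theorem comp_one (α : Setoid (A ⊕ B)) : comp α (one B) = α := by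
  apply ext_resp
  intro a b
  simp [resp_comp, resp_one]

theorem isBrauer_one : IsBrauer (one A) := by
  refine IsBrauer.of_partner Sum.swap ?_ ?_
  · rintro (x | x) <;> simp
  · rintro (x | x) (y | y)
    · change x = y ↔ _
      simp [eq_comm]
    · change x = y ↔ _
      simp [eq_comm]
    · change x = y ↔ _
      simp [eq_comm]
    · change x = y ↔ _
      simp [eq_comm]

theorem resp_star (α : Setoid (A ⊕ B)) (a : A → Prop) (b : B → Prop) :
    Resp (star α) b a ↔ Resp α a b := by
  constructor
  · intro h u v huv
    have := h u.swap v.swap (by change α u.swap.swap v.swap.swap; simpa using huv)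
    rcases u with u | u <;> rcases v with v | v <;> exact this
  · intro h u v huv
    have := h u.swap v.swap huv
    rcases u with u | u <;> rcases v with v | v <;> exact this

theorem star_star (α : Setoid (A ⊕ B)) : star (star α) = α := by
  apply ext_resp
  simp [resp_star]

theorem star_comp (α : Setoid (A ⊕ B)) (β : Setoid (B ⊕ C)) :
    star (comp α β) = comp (star β) (star α) := by
  apply ext_resp
  intro a b
  simp only [resp_star, resp_comp]
  exact exists_congr fun _ => and_comm

theorem star_one : star (one A) = one A := by
  apply ext_resp
  simp [resp_star, resp_one, eq_comm]

/-- As a relation on colourings, α is closed under zigzags: a cross edge imposes the same equation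
in each of the three copies, and these chain together. No size condition on the blocks is needed. -/
theorem comp_star_comp (α : Setoid (A ⊕ B)) : comp (comp α (star α)) α = α := by
  apply ext_resp
  intro a b
  simp only [resp_comp, resp_star]
  constructor
  · rintro ⟨a', ⟨b', h1, h2⟩, h3⟩ (u | u) (v | v) h
    · exact h1 _ _ h
    · exact (h1 _ _ h).trans ((h2 _ _ h).symm.trans (h3 _ _ h))
    · exact (h3 _ _ h).trans ((h2 _ _ h).symm.trans (h1 _ _ h))
    · exact h3 _ _ h
  · exact fun h => ⟨a, ⟨b, h, h⟩, h⟩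

theorem IsBrauer.eq_of_rel {α : Setoid (A ⊕ B)} (h : IsBrauer α) {x y z : A ⊕ B} (h1 : α x y)
    (h2 : α x z) (hy : y ≠ x) (hz : z ≠ x) : y = z := by
  obtain ⟨p, -, -, hp⟩ := h.exists_partner
  rw [((hp x y).1 h1).resolve_left hy, ((hp x z).1 h2).resolve_left hz]

/-- The upper vertices lying in transversals. -/
def dom (α : Setoid (A ⊕ B)) : Set A := {a | ∃ b, α (Sum.inl a) (Sum.inr b)}

/-- A transversal of size two has exactly one upper vertex, so it may be counted by that vertex. -/
theorem IsBrauer.rank_eq {α : Setoid (A ⊕ B)} (h : IsBrauer α) : rank α = (dom α).ncard := by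
  have : transversals α = (fun a => {y | α y (Sum.inl a)}) '' dom α := by
    ext X
    constructor
    · rintro ⟨⟨w, rfl⟩, ⟨a, ha⟩, ⟨b, hb⟩⟩
      refine ⟨a, ⟨b, α.trans' ha (α.symm' hb)⟩, ?_⟩
      ext y
      exact ⟨fun k => α.trans' k ha, fun k => α.trans' k (α.symm' ha)⟩
    · rintro ⟨a, ⟨b, hb⟩, rfl⟩
      exact ⟨⟨_, rfl⟩, ⟨a, α.refl' _⟩, ⟨b, α.symm' hb⟩⟩
  rw [rank, this, Set.InjOn.ncard_image]
  rintro a ⟨b, hb⟩ a' - e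
  have h1 : α (Sum.inl a) (Sum.inl a') := by
    have : Sum.inl a ∈ {y | α y (Sum.inl a)} := α.refl' _
    rw [show {y | α y (Sum.inl a)} = {y | α y (Sum.inl a')} from e] at this
    exact this
  by_contra hne
  have := h.eq_of_rel h1 hb (by simpa using fun k => hne k.symm) (by simp)
  cases this

theorem rank_star (α : Setoid (A ⊕ B)) : rank (star α) = rank α := by
  have key : ∀ {A B : Type} (α : Setoid (A ⊕ B)) X, X ∈ transversals α →
      Sum.swap ⁻¹' X ∈ transversals (star α) := by
    rintro A B α X ⟨⟨w, rfl⟩, ⟨a, ha⟩, ⟨b, hb⟩⟩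
    refine ⟨⟨w.swap, ?_⟩, ⟨b, hb⟩, ⟨a, ha⟩⟩
    ext y
    change α _ _ ↔ α _ _
    simp
  have : transversals (star α) = (fun X => Sum.swap ⁻¹' X) '' transversals α := by
    ext X
    constructor
    · intro hX
      refine ⟨Sum.swap ⁻¹' X, ?_, ?_⟩
      · simpa [star_star] using key _ _ hX
      · ext y
        simp
    · rintro ⟨Y, hY, rfl⟩
      exact key _ _ hY
  rw [rank, this, Set.ncard_image_of_injective _
    (Set.preimage_injective.2 Sum.swap_rightInverse.surjective)]
  rfl

theorem dom_comp_subset (α : Setoid (A ⊕ B)) (β : Setoid (B ⊕ C)) :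
    dom (comp α β) ⊆ dom α := by
  rintro a ⟨c, hc⟩
  by_contra hn
  -- If the block of `a` in α has no lower vertex, its indicator function extends by `False` to the
  -- other two rows and separates `a` from every bottom vertex.
  have key : Resp (comp α β) (fun x => α (Sum.inl a) (Sum.inl x)) (fun _ => False) := by
    rw [resp_comp]
    refine ⟨fun _ => False, ?_, ?_⟩
    · have e : ∀ w, Sum.elim (fun x => α (Sum.inl a) (Sum.inl x)) (fun _ => False) w
          = α (Sum.inl a) w := by
        rintro (w | w)
        · rfl
        · exact propext ⟨False.elim, fun k => hn ⟨w, k⟩⟩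
      intro u v huv
      rw [e, e]
      exact propext ⟨fun k => α.trans' k huv, fun k => α.trans' k (α.symm' huv)⟩
    · rintro (u | u) (v | v) _ <;> rfl
  exact (iff_of_eq (key _ _ hc)).1 (α.refl' (Sum.inl a))

/-! #### The partition `τ` -/

theorem resp_tau {R : Type} {σ : Setoid (A ⊕ B)} (e : R ≃ transversals σ) (c : R → Prop)
    (a : A → Prop) : Resp (tau σ e) c a ↔
      (∀ x y, σ (Sum.inl x) (Sum.inl y) → a x = a y) ∧
        ∀ i x, Sum.inl x ∈ (e i : Set (A ⊕ B)) → c i = a x := by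
  have hcl : ∀ x y, σ x y → {z | σ z x} = {z | σ z y} := by
    intro x y h
    ext z
    exact ⟨fun k => σ.trans' k h, fun k => σ.trans' k (σ.symm' h)⟩
  have hmem : ∀ i x, x ∈ (e i : Set (A ⊕ B)) → (e i : Set (A ⊕ B)) = {z | σ z x} := by
    intro i x hx
    obtain ⟨⟨w, hw⟩, -⟩ := (e i).2
    rw [hw] at hx ⊢
    exact hcl _ _ (σ.symm' hx)
  constructor
  · intro h
    exact ⟨fun x y hxy => h (Sum.inr x) (Sum.inr y) (hcl _ _ hxy),
      fun i x hx => h (Sum.inl i) (Sum.inr x) (hmem i _ hx)⟩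
  · rintro ⟨h1, h2⟩ (u | u) (v | v) h
    · have : e u = e v := Subtype.ext h
      rw [e.injective this]
    · refine h2 u v ?_
      rw [show (e u : Set (A ⊕ B)) = _ from h]
      exact σ.refl' _
    · refine (h2 v u ?_).symm
      rw [← show _ = (e v : Set (A ⊕ B)) from h]
      exact σ.refl' _
    · refine h1 u v ?_
      have : (Sum.inl u : A ⊕ B) ∈ {z | σ z (Sum.inl u)} := σ.refl' _
      rw [show {z | σ z (Sum.inl u)} = {z | σ z (Sum.inl v)} from h] at this
      exact this

/-- Both sides relate two colourings of `A` exactly when each is constant on the upper part of every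
block of σ and the two agree on transversals. This identity and `tau_comp_star` are all that is used
of τ in later computations. -/
theorem tau_star_comp {R : Type} {σ : Setoid (A ⊕ B)} (e : R ≃ transversals σ) :
    comp (star (tau σ e)) (tau σ e) = comp σ (star σ) := by
  have hmem : ∀ i x y, x ∈ (e i : Set (A ⊕ B)) → (y ∈ (e i : Set (A ⊕ B)) ↔ σ x y) := by
    intro i x y hx
    obtain ⟨⟨w, hw⟩, -⟩ := (e i).2
    rw [hw] at hx ⊢
    exact ⟨fun k => σ.trans' hx (σ.symm' k), fun k => σ.trans' (σ.symm' k) hx⟩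
  have hex : ∀ x y, σ (Sum.inl x) (Sum.inr y) → ∃ i, Sum.inl x ∈ (e i : Set (A ⊕ B)) := by
    intro x y h
    refine ⟨e.symm ⟨{z | σ z (Sum.inl x)}, ⟨_, rfl⟩, ⟨x, σ.refl' _⟩, ⟨y, σ.symm' h⟩⟩, ?_⟩
    rw [e.apply_symm_apply]
    exact σ.refl' _
  apply ext_resp
  intro a a'
  simp only [resp_comp, resp_star, resp_tau]
  constructor
  · rintro ⟨c, ⟨h1, h2⟩, h3, h4⟩
    have key : ∀ a : A → Prop, (∀ x y, σ (Sum.inl x) (Sum.inl y) → a x = a y) →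
        (∀ i x, Sum.inl x ∈ (e i : Set (A ⊕ B)) → c i = a x) →
        -- Lower vertices take the colour of their transversal; those in nontransversals are
        -- coloured `False`, which also keeps the lower blocks monochromatic.
        Resp σ a (fun y => ∃ i, Sum.inr y ∈ (e i : Set (A ⊕ B)) ∧ c i) := by
      intro a h1 h2
      have hlr : ∀ x y, σ (Sum.inl x) (Sum.inr y) →
          a x = ∃ i, Sum.inr y ∈ (e i : Set (A ⊕ B)) ∧ c i := by
        intro x y h
        apply propext
        constructor
        · intro hx
          obtain ⟨i, hi⟩ := hex x y h
          exact ⟨i, (hmem i _ _ hi).2 h, h2 i x hi ▸ hx⟩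
        · rintro ⟨i, hi, hc⟩
          exact h2 i x ((hmem i _ _ hi).2 (σ.symm' h)) ▸ hc
      rintro (u | u) (v | v) h
      · exact h1 u v h
      · exact hlr u v h
      · exact (hlr v u (σ.symm' h)).symm
      · apply propext
        exact exists_congr fun i => and_congr_left fun _ =>
          ⟨fun k => (hmem i _ _ k).2 h, fun k => (hmem i _ _ k).2 (σ.symm' h)⟩
    exact ⟨_, key a h1 h2, key a' h3 h4⟩
  · rintro ⟨b, h1, h2⟩
    have key : ∀ a : A → Prop, Resp σ a b → ∀ i x, Sum.inl x ∈ (e i : Set (A ⊕ B)) →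
        (∃ y, Sum.inr y ∈ (e i : Set (A ⊕ B)) ∧ b y) = a x := by
      intro a h i x hx
      apply propext
      constructor
      · rintro ⟨y, hy, hb⟩
        exact (iff_of_eq (h _ _ ((hmem i _ _ hx).1 hy))).2 hb
      · intro ha
        obtain ⟨-, -, ⟨y, hy⟩⟩ := (e i).2
        exact ⟨y, hy, (iff_of_eq (h _ _ ((hmem i _ _ hx).1 hy))).1 ha⟩
    exact ⟨_, ⟨fun x y h => h1 _ _ h, key a h1⟩, fun x y h => h2 _ _ h, key a' h2⟩

theorem tau_comp_star {R : Type} {σ : Setoid (A ⊕ B)} (e : R ≃ transversals σ) :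
    comp (tau σ e) (star (tau σ e)) = one R := by
  have hmem : ∀ i x y, x ∈ (e i : Set (A ⊕ B)) → (y ∈ (e i : Set (A ⊕ B)) ↔ σ x y) := by
    intro i x y hx
    obtain ⟨⟨w, hw⟩, -⟩ := (e i).2
    rw [hw] at hx ⊢
    exact ⟨fun k => σ.trans' hx (σ.symm' k), fun k => σ.trans' (σ.symm' k) hx⟩
  have hinj : ∀ i j x, x ∈ (e i : Set (A ⊕ B)) → x ∈ (e j : Set (A ⊕ B)) → i = j := by
    intro i j x hi hj
    apply e.injective
    apply Subtype.ext
    ext y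
    rw [hmem i x y hi, hmem j x y hj]
  apply ext_resp
  intro c c'
  simp only [resp_comp, resp_star, resp_tau, resp_one]
  constructor
  · rintro ⟨a, ⟨-, h1⟩, -, h2⟩
    funext i
    obtain ⟨-, ⟨x, hx⟩, -⟩ := (e i).2
    rw [h1 i x hx, h2 i x hx]
  · rintro rfl
    -- The middle colouring copies `c i` onto the upper vertices of the `i`-th transversal and is
    -- `False` on nontransversals; `hinj` shows that no vertex gets two colours.
    have : (∀ x y, σ (Sum.inl x) (Sum.inl y) →
        (∃ i, Sum.inl x ∈ (e i : Set (A ⊕ B)) ∧ c i) =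
          ∃ i, Sum.inl y ∈ (e i : Set (A ⊕ B)) ∧ c i) ∧
        ∀ i x, Sum.inl x ∈ (e i : Set (A ⊕ B)) →
          c i = ∃ i, Sum.inl x ∈ (e i : Set (A ⊕ B)) ∧ c i := by
      constructor
      · intro x y hxy
        apply propext
        exact exists_congr fun i => and_congr_left fun _ =>
          ⟨fun k => (hmem i _ _ k).2 hxy, fun k => (hmem i _ _ k).2 (σ.symm' hxy)⟩
      · intro i x hx
        apply propext
        exact ⟨fun k => ⟨i, hx, k⟩, fun ⟨j, hj, k⟩ => hinj i j _ hx hj ▸ k⟩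
    exact ⟨_, this, this⟩

end Diagram

/-! ### Frames and the factorization through the rank. -/

namespace Brauer

variable {k m n r q : ℕ}

/-- The identity of the Brauer category. -/
def one (m : ℕ) : Brauer m m := ⟨Diagram.one _, Diagram.isBrauer_one⟩

@[simp] theorem one_comp (α : Brauer m n) : (one m).comp α = α :=
  Subtype.ext (Diagram.one_comp α.1)

@[simp] theorem comp_one (α : Brauer m n) : α.comp (one n) = α :=
  Subtype.ext (Diagram.comp_one α.1)

@[simp] theorem star_star (α : Brauer m n) : α.star.star = α :=
  Subtype.ext (Diagram.star_star α.1)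

@[simp] theorem star_comp (α : Brauer m n) (β : Brauer n k) :
    (α.comp β).star = β.star.comp α.star :=
  Subtype.ext (Diagram.star_comp α.1 β.1)

@[simp] theorem star_one : (one m).star = one m := Subtype.ext Diagram.star_one

theorem comp_star_comp (α : Brauer m n) : α.comp (α.star.comp α) = α := by
  rw [← comp_assoc]
  exact Subtype.ext (Diagram.comp_star_comp α.1)

@[simp] theorem rank_star (α : Brauer m n) : α.star.rank = α.rank := Diagram.rank_star α.1

theorem rank_comp_le_left (α : Brauer m n) (β : Brauer n k) : (α.comp β).rank ≤ α.rank := by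
  change Diagram.rank (Diagram.comp α.1 β.1) ≤ Diagram.rank α.1
  rw [(α.2.comp β.2).rank_eq, α.2.rank_eq]
  exact Set.ncard_le_ncard (Diagram.dom_comp_subset α.1 β.1)

theorem rank_comp_le_right (α : Brauer m n) (β : Brauer n k) : (α.comp β).rank ≤ β.rank := by
  rw [← rank_star, star_comp, ← rank_star β]
  exact rank_comp_le_left _ _

theorem rank_one : (one m).rank = m := by
  refine (one m).2.rank_eq.trans ?_
  have : Diagram.dom (one m).1 = Set.univ := Set.eq_univ_of_forall fun a => ⟨a, rfl⟩
  rw [this, Set.ncard_univ, Nat.card_eq_fintype_card, Fintype.card_fin]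

/-- A Brauer partition in `B_{mq}` of full rank `q`, expressed by the equation `X* X = 1`. -/
def IsFrame (X : Brauer m q) : Prop := X.star.comp X = one q

theorem isFrame_tau_star (σ : Brauer n m) (e : Fin r ≃ Diagram.transversals σ.1) :
    IsFrame (σ.tau e).star := by
  rw [IsFrame, star_star]
  exact Subtype.ext (Diagram.tau_comp_star e)

theorem tau_star_comp (σ : Brauer n m) (e : Fin r ≃ Diagram.transversals σ.1) :
    (σ.tau e).star.comp (σ.tau e) = σ.comp σ.star :=
  Subtype.ext (Diagram.tau_star_comp e)

theorem IsFrame.cancel {X : Brauer m q} (h : IsFrame X) (α : Brauer q n) :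
    X.star.comp (X.comp α) = α := by
  rw [← comp_assoc, h, one_comp]

theorem IsFrame.left_cancel {X : Brauer m q} (h : IsFrame X) {α β : Brauer q n}
    (h' : X.comp α = X.comp β) : α = β := by
  rw [← h.cancel α, h', h.cancel]

theorem exists_rel_of_le_rank {X : Brauer m q} (h : q ≤ X.rank) (j : Fin q) :
    ∃ i, X.1 (Sum.inl i) (Sum.inr j) := by
  have hd : Diagram.dom X.star.1 = Set.univ := by
    apply Set.eq_of_subset_of_ncard_le (Set.subset_univ _)
    have h1 : X.star.rank = (Diagram.dom X.star.1).ncard := X.star.2.rank_eq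
    rw [← h1, rank_star, Set.ncard_univ, Nat.card_eq_fintype_card, Fintype.card_fin]
    exact h
  have : j ∈ Diagram.dom X.star.1 := hd ▸ Set.mem_univ j
  obtain ⟨i, hi⟩ := this
  exact ⟨i, X.1.symm' hi⟩

/-- When all lower vertices lie in transversals, a colouring of the upper row determines the lower
one, and every lower colouring arises. That is X* X = 1 in relational form. -/
theorem isFrame_of_exists_rel {X : Brauer m q} (hf : ∀ j, ∃ i, X.1 (Sum.inl i) (Sum.inr j)) :
    IsFrame X := by
  choose f hf using hf
  apply Subtype.ext
  apply Diagram.ext_resp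
  intro a b
  change Diagram.Resp (Diagram.comp (Diagram.star X.1) X.1) a b ↔ Diagram.Resp (Diagram.one _) a b
  simp only [Diagram.resp_comp, Diagram.resp_star, Diagram.resp_one]
  constructor
  · rintro ⟨c, h1, h2⟩
    funext j
    exact (h1 _ _ (hf j)).symm.trans (h2 _ _ (hf j))
  · rintro rfl
    have hu : ∀ i j j', X.1 (Sum.inl i) (Sum.inr j) → X.1 (Sum.inl i) (Sum.inr j') → j = j' :=
      fun i j j' h1 h2 => Sum.inr_injective (X.2.eq_of_rel h1 h2 (by simp) (by simp))
    -- An upper vertex takes the colour of its lower partner, unique by `hu`; upper vertices without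
    -- one are coloured `False`.
    have : Diagram.Resp X.1 (fun i => ∃ j, X.1 (Sum.inl i) (Sum.inr j) ∧ a j) a := by
      have hlr : ∀ i j, X.1 (Sum.inl i) (Sum.inr j) →
          (∃ j, X.1 (Sum.inl i) (Sum.inr j) ∧ a j) = a j := by
        intro i j h
        exact propext ⟨fun ⟨j', h', k⟩ => hu i j j' h h' ▸ k, fun k => ⟨j, h, k⟩⟩
      rintro (u | u) (v | v) h
      · apply propext
        exact exists_congr fun j => and_congr_left fun _ =>
          ⟨fun k => X.1.trans' (X.1.symm' h) k, fun k => X.1.trans' h k⟩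
      · exact hlr u v h
      · exact (hlr v u (X.1.symm' h)).symm
      · have h1 := hlr (f u) u (hf u)
        have h2 := hlr (f u) v (X.1.trans' (hf u) h)
        exact h1.symm.trans h2
    exact ⟨_, this, this⟩

theorem isFrame_of_le_rank {X : Brauer m q} (h : q ≤ X.rank) : IsFrame X :=
  isFrame_of_exists_rel (exists_rel_of_le_rank h)

theorem isFrame_iff {X : Brauer m q} : IsFrame X ↔ q ≤ X.rank := by
  refine ⟨fun h => ?_, isFrame_of_le_rank⟩
  have := rank_comp_le_right X.star X
  rwa [h, rank_one] at this

theorem rank_le_right (X : Brauer m q) : X.rank ≤ q := by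
  have := rank_comp_le_right X (one q)
  rwa [comp_one, rank_one] at this

/-- Multiplication cannot increase rank, and frames are the partitions of maximal rank q. -/
theorem isFrame_of_comp {α : Brauer m n} {X : Brauer n q} (h : IsFrame (α.comp X)) : IsFrame X :=
  isFrame_iff.2 ((isFrame_iff.1 h).trans (rank_comp_le_right _ _))

theorem IsFrame.comp {X : Brauer m n} {Y : Brauer n q} (hX : IsFrame X) (hY : IsFrame Y) :
    IsFrame (X.comp Y) := by
  rw [IsFrame, star_comp, comp_assoc, hX.cancel, hY]

theorem IsFrame.rank_comp_star {X : Brauer m q} {Y : Brauer n q} (hX : IsFrame X)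
    (hY : IsFrame Y) : (X.comp Y.star).rank = q := by
  apply le_antisymm
  · exact (rank_comp_le_left _ _).trans (rank_le_right X)
  · have h1 : X.star.comp ((X.comp Y.star).comp Y) = one q := by
      rw [comp_assoc, hX.cancel, hY]
    have h2 := rank_comp_le_right X.star ((X.comp Y.star).comp Y)
    rw [h1, rank_one] at h2
    exact h2.trans (rank_comp_le_left _ _)

/-- Each Brauer partition factors through its rank. -/
theorem exists_frames (α : Brauer m n) (h : α.rank = q) :
    ∃ (X : Brauer m q) (Y : Brauer n q), IsFrame X ∧ IsFrame Y ∧ α = X.comp Y.star := by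
  have hfin : Finite (Diagram.transversals α.1) := inferInstance
  have hcard : Nat.card (Fin q) = Nat.card (Diagram.transversals α.1) := by
    rw [Nat.card_eq_fintype_card, Fintype.card_fin, ← h]
    rfl
  have e : Fin q ≃ Diagram.transversals α.1 := (Finite.card_eq.1 hcard).some
  have hX := isFrame_tau_star α e
  have hτ := tau_star_comp α e
  -- With X = τ* and Y = α* τ*, where τ is taken for α, the product X Y* is τ* τ α = α α* α = α.
  refine ⟨(α.tau e).star, α.star.comp (α.tau e).star, hX, ?_, ?_⟩
  · rw [IsFrame]
    simp only [star_comp, star_star, comp_assoc]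
    rw [← comp_assoc α, ← hτ]
    simp only [IsFrame, star_star] at hX
    simp only [comp_assoc]
    rw [hX, comp_one, hX]
  · rw [star_comp, star_star, star_star, ← comp_assoc, hτ, comp_assoc, comp_star_comp]

end Brauer

/-! ### Permutations as Brauer partitions, and uniqueness of the factorization. -/

namespace Diagram

variable {A B : Type}

theorem IsBrauer.eq_of_le {α β : Setoid (A ⊕ B)} (hα : IsBrauer α) (hβ : IsBrauer β)
    (h : ∀ x y, α x y → β x y) : α = β := by
  obtain ⟨p, hp1, -, hp⟩ := hα.exists_partner
  ext x y
  refine ⟨h x y, fun k => ?_⟩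
  by_cases e : y = x
  · rw [e]
  · have hx := (hp x _).2 (Or.inr rfl)
    rw [hβ.eq_of_rel k (h _ _ hx) e (hp1 x)]
    exact hx

theorem isBrauer_ker_perm (π : Equiv.Perm A) : IsBrauer (Setoid.ker (Sum.elim id π)) := by
  refine IsBrauer.of_partner (Sum.elim (fun i => Sum.inr (π.symm i)) (fun j => Sum.inl (π j)))
    ?_ ?_
  · rintro (x | x) <;> simp
  · rintro (x | x) (y | y)
    · change x = y ↔ _
      simp [eq_comm]
    · change x = π y ↔ _
      simp [Equiv.eq_symm_apply, eq_comm]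
    · change π x = y ↔ _
      simp [eq_comm]
    · change π x = π y ↔ _
      simp [eq_comm]

theorem resp_ker_perm (π : Equiv.Perm A) (a b : A → Prop) :
    Resp (Setoid.ker (Sum.elim id π)) a b ↔ b = a ∘ π := by
  constructor
  · intro h
    funext x
    exact (h (Sum.inl (π x)) (Sum.inr x) rfl).symm
  · rintro rfl (u | u) (v | v) h <;> exact congrArg a h

end Diagram

namespace Brauer

variable {m n q : ℕ}

/-- The Brauer partition of a permutation, with blocks `{π j, j'}`. -/
def perm (π : Equiv.Perm (Fin q)) : Brauer q q :=
  ⟨Setoid.ker (Sum.elim id π), Diagram.isBrauer_ker_perm π⟩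

theorem perm_comp_perm (π ρ : Equiv.Perm (Fin q)) : (perm π).comp (perm ρ) = perm (π * ρ) := by
  apply Subtype.ext
  apply Diagram.ext_resp
  intro a b
  change Diagram.Resp (Diagram.comp (Setoid.ker _) (Setoid.ker _)) a b ↔
    Diagram.Resp (Setoid.ker (Sum.elim id (π * ρ : Equiv.Perm (Fin q)))) a b
  rw [Diagram.resp_comp, Diagram.resp_ker_perm]
  simp only [Diagram.resp_ker_perm, exists_eq_left]
  rfl

theorem perm_one : perm (1 : Equiv.Perm (Fin q)) = one q := rfl

theorem perm_star (π : Equiv.Perm (Fin q)) : (perm π).star = perm π⁻¹ := by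
  apply Subtype.ext
  apply Diagram.ext_resp
  intro a b
  change Diagram.Resp (Diagram.star (Setoid.ker _)) a b ↔ Diagram.Resp (Setoid.ker _) a b
  rw [Diagram.resp_star, Diagram.resp_ker_perm, Diagram.resp_ker_perm]
  constructor
  · rintro rfl
    funext x
    simp
  · rintro rfl
    funext x
    simp

theorem isFrame_perm (π : Equiv.Perm (Fin q)) : IsFrame (perm π) := by
  rw [IsFrame, perm_star, perm_comp_perm, inv_mul_cancel, perm_one]

theorem perm_injective : Function.Injective (perm : Equiv.Perm (Fin q) → Brauer q q) := by
  intro π ρ h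
  ext j
  have : (perm π).1 (Sum.inl (π j)) (Sum.inr j) := rfl
  rw [h] at this
  exact congrArg Fin.val (show π j = ρ j from this)

/-- The lower vertices of a frame are joined to distinct upper vertices. -/
theorem IsFrame.exists_embedding {X : Brauer m q} (h : IsFrame X) :
    ∃ f : Fin q ↪ Fin m, ∀ j, X.1 (Sum.inl (f j)) (Sum.inr j) := by
  choose f hf using exists_rel_of_le_rank (isFrame_iff.1 h)
  refine ⟨⟨f, fun i j hij => ?_⟩, hf⟩
  have h1 := hf i
  rw [hij] at h1
  exact Sum.inr_injective (X.2.eq_of_rel h1 (hf j) (by simp) (by simp))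

/-- The transversals give an injection of a q-element set into itself, hence a permutation. Its
diagram refines α, and one Brauer partition refines another only if they are equal. -/
theorem IsFrame.exists_perm {α : Brauer q q} (h : IsFrame α) : ∃ π, α = perm π := by
  obtain ⟨f, hf⟩ := h.exists_embedding
  let π : Equiv.Perm (Fin q) := Equiv.ofBijective f (Finite.injective_iff_bijective.1 f.injective)
  have hα : ∀ j, α.1 (Sum.inl (π j)) (Sum.inr j) := hf
  refine ⟨π, (Subtype.ext ((perm π).2.eq_of_le α.2 ?_)).symm⟩
  rintro (x | x) (y | y) hxy
  · rw [show x = y from hxy]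
  · rw [show x = π y from hxy]
    exact hα y
  · rw [← show π x = y from hxy]
    exact α.1.symm' (hα x)
  · rw [π.injective (show π x = π y from hxy)]

theorem IsFrame.comp_perm {X : Brauer m q} (h : IsFrame X) (π : Equiv.Perm (Fin q)) :
    IsFrame (X.comp (perm π)) := h.comp (isFrame_perm π)

theorem comp_perm_comp_perm (X : Brauer m q) (π ρ : Equiv.Perm (Fin q)) :
    (X.comp (perm π)).comp (perm ρ) = X.comp (perm (π * ρ)) := by
  rw [comp_assoc, perm_comp_perm]

theorem IsFrame.perm_eq {X : Brauer m q} (h : IsFrame X) {π ρ : Equiv.Perm (Fin q)}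
    (h' : X.comp (perm π) = X.comp (perm ρ)) : π = ρ :=
  perm_injective (h.left_cancel h')

/-- Uniqueness of the factorization through the rank. -/
theorem comp_star_eq_iff {X X' : Brauer m q} {Y Y' : Brauer n q} (hX : IsFrame X)
    (hX' : IsFrame X') (hY' : IsFrame Y') :
    X.comp Y.star = X'.comp Y'.star ↔
      ∃ π, X' = X.comp (perm π) ∧ Y' = Y.comp (perm π) := by
  constructor
  · intro h
    -- Multiplying by Y' on the right removes Y'*. Since X' is a frame, so is Y* Y' in B_{qq}, which
    -- is therefore a permutation.
    have h1 : X' = X.comp (Y.star.comp Y') := by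
      rw [← comp_assoc, h, comp_assoc, hY', comp_one]
    obtain ⟨π, hπ⟩ := (isFrame_of_comp (h1 ▸ hX')).exists_perm
    rw [hπ] at h1
    refine ⟨π, h1, ?_⟩
    have h2 : Y.star = (perm π).comp Y'.star := by
      rw [← hX.cancel Y.star, h, h1, comp_assoc, hX.cancel]
    have h3 : Y = Y'.comp (perm π⁻¹) := by
      rw [← star_star Y, h2, star_comp, star_star, perm_star]
    rw [h3, comp_perm_comp_perm, inv_mul_cancel, perm_one, comp_one]
  · rintro ⟨π, rfl, rfl⟩
    rw [star_comp, perm_star, comp_assoc, ← comp_assoc (perm π), perm_comp_perm, mul_inv_cancel,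
      perm_one, one_comp]

end Brauer

/-! ### Counting -/

section FixedPointFreeInvolutions

variable (Z : Type)

/-- The fixed-point-free involutions of a type. -/
def FPFInvolution : Type := {p : Equiv.Perm Z // (∀ x, p x ≠ x) ∧ ∀ x, p (p x) = x}

variable [Fintype Z] [DecidableEq Z]

theorem cycleType_eq_replicate_iff (hZ : Even (Fintype.card Z)) (p : Equiv.Perm Z) :
    p.cycleType = Multiset.replicate (Fintype.card Z / 2) 2 ↔
      (∀ x, p x ≠ x) ∧ ∀ x, p (p x) = x := by
  have hs : (∀ x, p x ≠ x) ↔ p.support.card = Fintype.card Z := by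
    rw [Finset.card_eq_iff_eq_univ, Finset.eq_univ_iff_forall]
    simp only [Equiv.Perm.mem_support]
  have h2 : (∀ x, p (p x) = x) ↔ p ^ 2 = 1 := by
    rw [Equiv.Perm.ext_iff]
    simp [pow_two]
  have : Fact (Nat.Prime 2) := ⟨Nat.prime_two⟩
  rw [hs, h2]
  obtain ⟨k, hk⟩ := hZ
  constructor
  · intro h
    refine ⟨?_, Equiv.Perm.pow_prime_eq_one_iff.2 fun c hc => ?_⟩
    · rw [← Equiv.Perm.sum_cycleType, h, Multiset.sum_replicate, smul_eq_mul]
      omega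
    · rw [h] at hc
      exact Multiset.eq_of_mem_replicate hc
  · rintro ⟨h1, h3⟩
    have h4 := Equiv.Perm.cycleType_of_pow_prime_eq_one h3
    have h5 := p.sum_cycleType
    rw [h4, Multiset.sum_replicate, smul_eq_mul, h1] at h5
    rw [h4]
    congr 1
    omega

/-- On 2k points these involutions form the conjugacy class of cycle type 2^k, of size (2k)!/(2^k
k!), and 2^k k! = (2k)!!. -/
theorem card_fpfInvolution (hZ : Even (Fintype.card Z)) :
    Nat.card (FPFInvolution Z) = predDoubleFactorial (Fintype.card Z) := by
  have h1 : Nat.card (FPFInvolution Z) = (Finset.univ.filter fun p : Equiv.Perm Z =>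
      p.cycleType = Multiset.replicate (Fintype.card Z / 2) 2).card := by
    rw [FPFInvolution, Nat.card_eq_fintype_card, Fintype.card_subtype]
    congr 1
    ext p
    simp [cycleType_eq_replicate_iff Z hZ]
  have h2 := Equiv.Perm.card_of_cycleType_mul_eq Z
    (Multiset.replicate (Fintype.card Z / 2) 2)
  rw [← h1] at h2
  obtain ⟨k, hk⟩ := hZ
  have hk2 : Fintype.card Z / 2 = k := by omega
  have hZ2 : Fintype.card Z = 2 * k := by omega
  rw [hk2, hZ2, Multiset.sum_replicate, Multiset.prod_replicate, smul_eq_mul, mul_comm k 2,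
    Nat.sub_self, Nat.factorial_zero, one_mul, if_pos ⟨le_rfl, fun a ha => by
      rw [Multiset.eq_of_mem_replicate ha]⟩] at h2
  have h3 : ∏ n ∈ (Multiset.replicate k 2).toFinset, (Multiset.count n (Multiset.replicate k 2))!
      = k ! := by
    rcases Nat.eq_zero_or_pos k with rfl | hpos
    · simp
    · rw [Multiset.toFinset_replicate, if_neg hpos.ne', Finset.prod_singleton,
        Multiset.count_replicate_self]
  rw [h3, ← Nat.doubleFactorial_two_mul] at h2
  rw [hZ2, predDoubleFactorial]
  apply Nat.eq_of_mul_eq_mul_right (Nat.doubleFactorial_pos (2 * k))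
  rw [h2]
  -- For k = 0 truncated subtraction yields 0‼ = 1, in agreement with (-1)!! = 1.
  rcases k with _ | k
  · rfl
  · exact (Nat.factorial_eq_mul_doubleFactorial (2 * k + 1)).trans (mul_comm _ _)

end FixedPointFreeInvolutions

/-! ### Brauer partitions as fixed-point-free involutions, and their relabellings. -/

namespace Diagram

variable {A B : Type}

/-- The Brauer partition whose blocks are the orbits of a fixed-point-free involution. -/
def ofInvolution (p : FPFInvolution (A ⊕ B)) : {α : Setoid (A ⊕ B) // IsBrauer α} :=
  ⟨⟨fun x y => y = x ∨ y = p.1 x, fun _ => Or.inl rfl, by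
      rintro x y (rfl | rfl)
      · exact Or.inl rfl
      · exact Or.inr (p.2.2 x).symm, by
      rintro x y z (rfl | rfl) (rfl | rfl)
      · exact Or.inl rfl
      · exact Or.inr rfl
      · exact Or.inr rfl
      · exact Or.inl (p.2.2 x)⟩, IsBrauer.of_partner p.1 p.2.1 fun _ _ => Iff.rfl⟩

/-- Brauer partitions correspond to fixed-point-free involutions. -/
noncomputable def equivFPFInvolution :
    {α : Setoid (A ⊕ B) // IsBrauer α} ≃ FPFInvolution (A ⊕ B) where
  toFun α := ⟨⟨α.2.exists_partner.choose, α.2.exists_partner.choose,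
    α.2.exists_partner.choose_spec.2.1, α.2.exists_partner.choose_spec.2.1⟩,
    α.2.exists_partner.choose_spec.1, α.2.exists_partner.choose_spec.2.1⟩
  invFun := ofInvolution
  left_inv α := by
    apply Subtype.ext
    ext x y
    exact (α.2.exists_partner.choose_spec.2.2 x y).symm
  right_inv p := by
    apply Subtype.ext
    ext x
    have h := (ofInvolution p).2.exists_partner.choose_spec
    have h1 : (ofInvolution p).1 x ((ofInvolution p).2.exists_partner.choose x) :=
      (h.2.2 x _).2 (Or.inr rfl)
    exact Or.resolve_left h1 (h.1 x)

theorem equivFPFInvolution_symm_rel (p : FPFInvolution (A ⊕ B)) (x y : A ⊕ B) :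
    (equivFPFInvolution.symm p).1 x y ↔ y = x ∨ y = p.1 x := Iff.rfl

theorem card_isBrauer [Fintype A] [Fintype B] (h : Even (Fintype.card A + Fintype.card B)) :
    Nat.card {α : Setoid (A ⊕ B) // IsBrauer α} =
      predDoubleFactorial (Fintype.card A + Fintype.card B) := by
  classical
  rw [Nat.card_congr equivFPFInvolution, card_fpfInvolution, Fintype.card_sum]
  rwa [Fintype.card_sum]

theorem IsBrauer.even_card [Fintype A] [Fintype B] {α : Setoid (A ⊕ B)} (h : IsBrauer α) :
    Even (Fintype.card A + Fintype.card B) := by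
  obtain ⟨p, h1, h2, -⟩ := h.exists_partner
  rw [← Fintype.card_sum, ← Finset.card_univ]
  exact even_card_of_partner _ p (fun _ _ => Finset.mem_univ _) (fun x _ => h1 x) fun x _ => h2 x

theorem IsBrauer.relabel {α : Setoid (A ⊕ B)} (h : IsBrauer α) (g : Equiv.Perm (A ⊕ B)) :
    IsBrauer (α.comap g.symm) := by
  obtain ⟨p, h1, -, h3⟩ := h.exists_partner
  refine IsBrauer.of_partner (fun x => g (p (g.symm x))) (fun x hx => h1 (g.symm x) ?_) ?_
  · exact (g.eq_symm_apply).2 hx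
  · intro x y
    rw [Setoid.comap_rel, h3, g.symm.apply_eq_iff_eq, g.symm_apply_eq]

/-- Relabelling of vertices is transitive on Brauer partitions. -/
theorem IsBrauer.exists_relabel [Finite A] [Finite B] {α β : Setoid (A ⊕ B)} (hα : IsBrauer α)
    (hβ : IsBrauer β) : ∃ g : Equiv.Perm (A ⊕ B), α.comap g.symm = β := by
  classical
  have := Fintype.ofFinite A
  have := Fintype.ofFinite B
  have he : Even (Fintype.card (A ⊕ B)) := by
    rw [Fintype.card_sum]
    exact hα.even_card
  let a := equivFPFInvolution ⟨α, hα⟩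
  let b := equivFPFInvolution ⟨β, hβ⟩
  have ha : ∀ x y, α x y ↔ y = x ∨ y = a.1 x := fun x y => by
    rw [← equivFPFInvolution_symm_rel, Equiv.symm_apply_apply]
  have hb : ∀ x y, β x y ↔ y = x ∨ y = b.1 x := fun x y => by
    rw [← equivFPFInvolution_symm_rel, Equiv.symm_apply_apply]
  -- Fixed-point-free involutions of one set share a cycle type; a conjugating permutation is the
  -- relabelling sought.
  have hconj : IsConj a.1 b.1 := by
    rw [Equiv.Perm.isConj_iff_cycleType_eq, (cycleType_eq_replicate_iff _ he a.1).2 a.2,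
      (cycleType_eq_replicate_iff _ he b.1).2 b.2]
  obtain ⟨g, hg⟩ := isConj_iff.1 hconj
  refine ⟨g, ?_⟩
  ext x y
  rw [Setoid.comap_rel, ha, hb, g.symm.apply_eq_iff_eq, g.symm_apply_eq, ← hg]
  rfl

theorem resp_relabel (α : Setoid (A ⊕ B)) (g : Equiv.Perm (A ⊕ B)) (h : A ⊕ B → Prop) :
    Resp (α.comap g.symm) (h ∘ Sum.inl) (h ∘ Sum.inr) ↔
      Resp α (h ∘ g ∘ Sum.inl) (h ∘ g ∘ Sum.inr) := by
  simp only [Resp, Setoid.comap_rel, ← Function.comp_assoc, Sum.elim_comp_inl_inr,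
    Function.comp_apply]
  constructor
  · intro k u v huv
    exact k (g u) (g v) (by simpa using huv)
  · intro k u v huv
    simpa using k _ _ huv

end Diagram

/-! ### The fibres of contraction by a partition of full rank. -/

namespace Brauer

variable {m n r q : ℕ}

instance : Finite (Brauer m n) := by
  have : Finite (Setoid (Fin m ⊕ Fin n)) :=
    Finite.of_injective (fun s : Setoid (Fin m ⊕ Fin n) => fun x y => s x y)
      fun s t h => Setoid.ext fun x y => iff_of_eq (congrFun (congrFun h x) y)
  exact Subtype.finite

theorem even_add (α : Brauer m n) : Even (m + n) := by simpa using α.2.even_card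

theorem card_brauer (h : Even (m + n)) : Nat.card (Brauer m n) = predDoubleFactorial (m + n) := by
  have := Diagram.card_isBrauer (A := Fin m) (B := Fin n) (by simpa using h)
  rwa [Fintype.card_fin, Fintype.card_fin] at this

/-- Relabelling of the vertices. -/
def relabel (g : Equiv.Perm (Fin m ⊕ Fin n)) (α : Brauer m n) : Brauer m n :=
  ⟨α.1.comap g.symm, α.2.relabel g⟩

theorem relabel_injective (g : Equiv.Perm (Fin m ⊕ Fin n)) : Function.Injective (relabel g) := by
  intro α β h
  apply Subtype.ext
  ext x y
  have h1 : ∀ γ : Brauer m n, γ.1 x y ↔ (relabel g γ).1 (g x) (g y) := fun γ => by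
    change _ ↔ γ.1 (g.symm (g x)) (g.symm (g y))
    simp
  rw [h1, h, ← h1]

/-- Contraction by a partition of full rank is equivariant for relabelling. -/
theorem exists_relabel_comp {T : Brauer r m} (hT : IsFrame T.star)
    (g : Equiv.Perm (Fin r ⊕ Fin q)) :
    ∃ g' : Equiv.Perm (Fin m ⊕ Fin q), ∀ X : Brauer m q,
      T.comp (relabel g' X) = relabel g (T.comp X) := by
  obtain ⟨f, hf⟩ := hT.exists_embedding
  replace hf : ∀ j, T.1 (Sum.inl j) (Sum.inr (f j)) := fun j => T.1.symm' (hf j)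
  let ι : Fin r ⊕ Fin q ↪ Fin m ⊕ Fin q := f.sumMap (Function.Embedding.refl _)
  -- `ι` marks the vertices that remain visible after contraction: the lower ends of the
  -- transversals of T and the q bottom vertices. The lift acts there as `g` and fixes the vertices
  -- that T joins among themselves.
  let g' := g.viaEmbedding ι
  have hgι : g' ∘ ι = ι ∘ g := funext fun x => Equiv.Perm.viaEmbedding_apply g ι x
  -- These are the colourings compatible with the lower nontransversals of T. `hN` and `hg'N` hold
  -- because `g'` fixes all vertices of those blocks.
  let N : (Fin m ⊕ Fin q → Prop) → Prop := fun h =>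
    ∀ x y, T.1 (Sum.inr x) (Sum.inr y) → h (Sum.inl x) = h (Sum.inl y)
  have hfix : ∀ x y, T.1 (Sum.inr x) (Sum.inr y) → x ≠ y → g' (Sum.inl x) = Sum.inl x := by
    intro x y hxy hne
    refine Equiv.Perm.viaEmbedding_apply_of_notMem g ι _ ?_
    rintro ⟨z | z, hz⟩
    · have hz' : f z = x := Sum.inl_injective hz
      have h1 := T.1.symm' (hf z)
      rw [hz'] at h1
      cases T.2.eq_of_rel hxy h1 (by simpa using hne.symm) (by simp)
    · cases hz
  have hN : ∀ h, N h → N (h ∘ g') := by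
    intro h hh x y hxy
    by_cases hne : x = y
    · rw [hne]
    · simp only [Function.comp_apply]
      rw [hfix x y hxy hne, hfix y x (T.1.symm' hxy) (Ne.symm hne)]
      exact hh x y hxy
  have hg'N : ∀ h, N (h ∘ g') → N h := by
    intro h hh x y hxy
    by_cases hne : x = y
    · rw [hne]
    · have := hh x y hxy
      simp only [Function.comp_apply] at this
      rwa [hfix x y hxy hne, hfix y x (T.1.symm' hxy) (Ne.symm hne)] at this
  have hT : ∀ a b, Diagram.Resp T.1 a b ↔ b ∘ f = a ∧
      ∀ x y, T.1 (Sum.inr x) (Sum.inr y) → b x = b y := by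
    intro a b
    constructor
    · exact fun h => ⟨funext fun j => (h _ _ (hf j)).symm, fun x y hxy => h _ _ hxy⟩
    · rintro ⟨rfl, h⟩ (u | u) (v | v) huv
      · exact h _ _ (T.1.trans' (T.1.symm' (hf u)) (T.1.trans' huv (hf v)))
      · exact h _ _ (T.1.trans' (T.1.symm' (hf u)) huv)
      · exact h _ _ (T.1.trans' huv (hf v))
      · exact h _ _ huv
  -- The colourings of T X are the restrictions along `ι` of colourings of X that lie in `N`. Since
  -- `g'` preserves `N` and intertwines `ι`, equivariance follows.
  have key : ∀ (X : Brauer m q) (k : Fin r ⊕ Fin q → Prop),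
      Diagram.Resp (T.comp X).1 (k ∘ Sum.inl) (k ∘ Sum.inr) ↔
        ∃ h, h ∘ ι = k ∧ N h ∧ Diagram.Resp X.1 (h ∘ Sum.inl) (h ∘ Sum.inr) := by
    intro X k
    refine (Diagram.resp_comp T.1 X.1 _ _).trans ?_
    constructor
    · rintro ⟨b, h1, h2⟩
      rw [hT] at h1
      refine ⟨Sum.elim b (k ∘ Sum.inr), ?_, h1.2, h2⟩
      funext x
      rcases x with x | x
      · exact congrFun h1.1 x
      · rfl
    · rintro ⟨h, rfl, h1, h2⟩
      exact ⟨h ∘ Sum.inl, (hT _ _).2 ⟨rfl, h1⟩, h2⟩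
  refine ⟨g', fun X => Subtype.ext (Diagram.ext_resp fun a c => ?_)⟩
  obtain ⟨k, rfl, rfl⟩ : ∃ k : Fin r ⊕ Fin q → Prop, k ∘ Sum.inl = a ∧ k ∘ Sum.inr = c :=
    ⟨Sum.elim a c, rfl, rfl⟩
  rw [key]
  change _ ↔ Diagram.Resp ((T.comp X).1.comap g.symm) _ _
  rw [Diagram.resp_relabel]
  refine Iff.trans ?_ (key X (k ∘ g)).symm
  constructor
  · rintro ⟨h, rfl, h1, h2⟩
    refine ⟨h ∘ g', ?_, hN h h1, (Diagram.resp_relabel X.1 g' h).1 h2⟩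
    rw [Function.comp_assoc, hgι, Function.comp_assoc]
  · rintro ⟨h', h0, h1, h2⟩
    obtain ⟨h, rfl⟩ : ∃ h, h' = h ∘ g' := ⟨h' ∘ g'.symm, by
      rw [Function.comp_assoc, Equiv.symm_comp_self, Function.comp_id]⟩
    refine ⟨h, ?_, hg'N h h1, (Diagram.resp_relabel X.1 g' h).2 h2⟩
    rw [Function.comp_assoc, hgι, ← Function.comp_assoc] at h0
    exact g.surjective.injective_comp_right h0

/-- A relabelling that takes Z to Z' lifts to an injection between the fibres. Exchanging Z and Z'
gives equality. -/
theorem card_fibre_le {T : Brauer r m} (hT : IsFrame T.star) (Z Z' : Brauer r q) :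
    Nat.card {X : Brauer m q // T.comp X = Z} ≤ Nat.card {X : Brauer m q // T.comp X = Z'} := by
  obtain ⟨g, hg⟩ := Z.2.exists_relabel Z'.2
  obtain ⟨g', hg'⟩ := exists_relabel_comp hT g
  refine Nat.card_le_card_of_injective
    (fun X => ⟨relabel g' X.1, by rw [hg', X.2]; exact Subtype.ext hg⟩) fun X Y h => ?_
  exact Subtype.ext (relabel_injective g' (congrArg Subtype.val h))

/-- The fibres of contraction by a partition of full rank all have the same size. -/
theorem card_fibre {T : Brauer r m} (hT : IsFrame T.star) (Z : Brauer r q) :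
    (Nat.card {X : Brauer m q // T.comp X = Z} : ℚ) =
      (predDoubleFactorial (m + q) : ℚ) / predDoubleFactorial (r + q) := by
  have hr : Even (r + q) := Z.even_add
  have hm : Even (m + q) := (T.star.comp Z).even_add
  -- B_{mq} is partitioned into the fibres over B_{rq}, all of one size, so that size is a quotient
  -- of two double factorials.
  have hsum : Nat.card (Brauer m q) =
      Nat.card (Brauer r q) * Nat.card {X : Brauer m q // T.comp X = Z} := by
    have := Fintype.ofFinite (Brauer r q)
    rw [Nat.card_congr (Equiv.sigmaFiberEquiv fun X : Brauer m q => T.comp X).symm, Nat.card_sigma,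
      Finset.sum_congr rfl fun Z' _ => le_antisymm (card_fibre_le hT Z' Z) (card_fibre_le hT Z Z'),
      Finset.sum_const, smul_eq_mul, Finset.card_univ, ← Nat.card_eq_fintype_card]
  rw [card_brauer hr, card_brauer hm] at hsum
  have hpos : (predDoubleFactorial (r + q) : ℚ) ≠ 0 :=
    Nat.cast_ne_zero.2 (Nat.doubleFactorial_pos _).ne'
  rw [eq_div_iff hpos, mul_comm]
  exact_mod_cast hsum.symm

end Brauer

/-! ### Brauer partitions with prescribed transversals. -/

namespace Diagram

variable {A B : Type}

/-- The upper vertices outside the range of `f`, together with no lower vertices. -/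
def coRange (f : B ↪ A) : {a // a ∉ Set.range f} ⊕ Empty → A ⊕ B := Sum.map Subtype.val Empty.elim

theorem coRange_injective (f : B ↪ A) : Function.Injective (coRange f) := by
  rintro (⟨x, _⟩ | x) (⟨y, _⟩ | y) h
  · cases h
    rfl
  · exact y.elim
  · exact x.elim
  · exact x.elim

/-- The pairs {f j, j'} are already whole blocks, so the partner of a vertex outside them is again
outside. -/
theorem IsBrauer.exists_coRange {f : B ↪ A} {α : Setoid (A ⊕ B)} (h : IsBrauer α)
    (hf : ∀ j, α (Sum.inl (f j)) (Sum.inr j)) (x : {a // a ∉ Set.range f} ⊕ Empty) {y : A ⊕ B}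
    (hxy : α (coRange f x) y) : ∃ z, coRange f z = y := by
  rcases x with ⟨x, hx⟩ | x
  · by_cases hy : y = Sum.inl x
    · exact ⟨Sum.inl ⟨x, hx⟩, hy.symm⟩
    · rcases y with y | y
      · refine ⟨Sum.inl ⟨y, ?_⟩, rfl⟩
        rintro ⟨j, rfl⟩
        cases h.eq_of_rel (α.symm' hxy) (hf j) (Ne.symm hy) (by simp)
      · refine absurd ⟨y, ?_⟩ hx
        exact Sum.inl_injective
          (h.eq_of_rel (α.symm' (hf y)) (α.symm' hxy) (by simp) (by simp))
  · exact x.elim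

theorem IsBrauer.comap_coRange {f : B ↪ A} {α : Setoid (A ⊕ B)} (h : IsBrauer α)
    (hf : ∀ j, α (Sum.inl (f j)) (Sum.inr j)) : IsBrauer (α.comap (coRange f)) := by
  obtain ⟨p, h1, -, h3⟩ := h.exists_partner
  choose g hg using fun x => h.exists_coRange hf x ((h3 _ _).2 (Or.inr rfl))
  refine IsBrauer.of_partner g (fun x hx => h1 (coRange f x) ?_) fun x y => ?_
  · rw [← hg, hx]
  · rw [Setoid.comap_rel, h3, ← hg, (coRange_injective f).eq_iff, (coRange_injective f).eq_iff]

/-- A Brauer partition on the upper vertices outside the range of `f` extends by the blocks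
`{f j, j'}`. -/
theorem exists_extension (f : B ↪ A) {s : Setoid ({a // a ∉ Set.range f} ⊕ Empty)}
    (hs : IsBrauer s) : ∃ α : Setoid (A ⊕ B), IsBrauer α ∧
      (∀ j, α (Sum.inl (f j)) (Sum.inr j)) ∧ α.comap (coRange f) = s := by
  have hcase : ∀ a : A ⊕ B, (∃ j, a = Sum.inl (f j)) ∨ (∃ j, a = Sum.inr j) ∨
      ∃ x, a = coRange f x := by
    rintro (a | b)
    · by_cases h : a ∈ Set.range f
      · obtain ⟨j, rfl⟩ := h
        exact Or.inl ⟨j, rfl⟩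
      · exact Or.inr (Or.inr ⟨Sum.inl ⟨a, h⟩, rfl⟩)
    · exact Or.inr (Or.inl ⟨b, rfl⟩)
  have hne1 : ∀ x j, coRange f x ≠ Sum.inl (f j) := by
    rintro (⟨x, hx⟩ | x) j h
    · exact hx ⟨j, (Sum.inl_injective h).symm⟩
    · exact x.elim
  have hne2 : ∀ x j, coRange f x ≠ Sum.inr j := by
    rintro (⟨x, hx⟩ | x) j h
    · cases h
    · exact x.elim
  -- Each vertex is labelled by its intended block, either a block of `s` or an index j; the
  -- extension is the kernel of this labelling.
  have hlabel : ∃ l : A ⊕ B → Quotient s ⊕ B, (∀ j, l (Sum.inl (f j)) = Sum.inr j) ∧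
      (∀ j, l (Sum.inr j) = Sum.inr j) ∧ ∀ x, l (coRange f x) = Sum.inl (Quotient.mk s x) := by
    have : ∀ a : A ⊕ B, ∃ w : Quotient s ⊕ B, (∀ j, a = Sum.inl (f j) → w = Sum.inr j) ∧
        (∀ j, a = Sum.inr j → w = Sum.inr j) ∧
          ∀ x, a = coRange f x → w = Sum.inl (Quotient.mk s x) := by
      intro a
      rcases hcase a with ⟨j, rfl⟩ | ⟨j, rfl⟩ | ⟨x, rfl⟩
      · refine ⟨Sum.inr j, fun i h => ?_, fun i h => ?_, fun x h => absurd h.symm (hne1 x j)⟩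
        · rw [f.injective (Sum.inl_injective h)]
        · cases h
      · refine ⟨Sum.inr j, fun i h => ?_, fun i h => ?_, fun x h => absurd h.symm (hne2 x j)⟩
        · cases h
        · rw [Sum.inr_injective h]
      · refine ⟨Sum.inl (Quotient.mk s x), fun i h => absurd h (hne1 x i),
          fun i h => absurd h (hne2 x i), fun y h => ?_⟩
        rw [coRange_injective f h]
    choose l hl using this
    exact ⟨l, fun j => (hl _).1 j rfl, fun j => (hl _).2.1 j rfl, fun x => (hl _).2.2 x rfl⟩
  obtain ⟨l, hl1, hl2, hl3⟩ := hlabel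
  have hrel : ∀ x y, Setoid.ker l (coRange f x) (coRange f y) ↔ s x y := by
    intro x y
    change l _ = l _ ↔ _
    rw [hl3, hl3, Sum.inl_injective.eq_iff, Quotient.eq]
  obtain ⟨p, hp1, -, hp3⟩ := hs.exists_partner
  have key : ∀ a, ∃ b, b ≠ a ∧ ∀ z, Setoid.ker l a z ↔ z = a ∨ z = b := by
    intro a
    rcases hcase a with ⟨j, rfl⟩ | ⟨j, rfl⟩ | ⟨x, rfl⟩
    · refine ⟨Sum.inr j, by simp, fun z => ?_⟩
      change l _ = l z ↔ _
      rw [hl1]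
      rcases hcase z with ⟨i, rfl⟩ | ⟨i, rfl⟩ | ⟨x, rfl⟩
      · rw [hl1]
        simp [eq_comm]
      · rw [hl2]
        simp [eq_comm]
      · rw [hl3]
        simp [hne1, hne2]
    · refine ⟨Sum.inl (f j), by simp, fun z => ?_⟩
      change l _ = l z ↔ _
      rw [hl2]
      rcases hcase z with ⟨i, rfl⟩ | ⟨i, rfl⟩ | ⟨x, rfl⟩
      · rw [hl1]
        simp [eq_comm]
      · rw [hl2]
        simp [eq_comm]
      · rw [hl3]
        simp [hne1, hne2]
    · refine ⟨coRange f (p x), fun h => hp1 x (coRange_injective f h), fun z => ?_⟩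
      rcases hcase z with ⟨i, rfl⟩ | ⟨i, rfl⟩ | ⟨y, rfl⟩
      · change l _ = l _ ↔ _
        rw [hl1, hl3]
        simp [(hne1 _ _).symm]
      · change l _ = l _ ↔ _
        rw [hl2, hl3]
        simp [(hne2 _ _).symm]
      · rw [hrel, hp3, (coRange_injective f).eq_iff, (coRange_injective f).eq_iff]
  choose b hb1 hb2 using key
  refine ⟨Setoid.ker l, IsBrauer.of_partner b hb1 hb2, fun j => ?_, ?_⟩
  · exact (hl1 j).trans (hl2 j).symm
  · ext x y
    exact hrel x y

theorem IsBrauer.eq_of_comap_coRange {f : B ↪ A} {α β : Setoid (A ⊕ B)} (hα : IsBrauer α)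
    (hβ : IsBrauer β) (hfα : ∀ j, α (Sum.inl (f j)) (Sum.inr j))
    (hfβ : ∀ j, β (Sum.inl (f j)) (Sum.inr j))
    (h : α.comap (coRange f) = β.comap (coRange f)) : α = β := by
  have main : ∀ x y, α (coRange f x) y → β (coRange f x) y := by
    intro x y hxy
    obtain ⟨z, rfl⟩ := hα.exists_coRange hfα x hxy
    have : α.comap (coRange f) x z := hxy
    rw [h] at this
    exact this
  have hlr : ∀ j y, α (Sum.inl (f j)) y → β (Sum.inl (f j)) y := by
    intro j y hy
    by_cases e : y = Sum.inl (f j)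
    · rw [e]
    · rw [hα.eq_of_rel hy (hfα j) e (by simp)]
      exact hfβ j
  refine hα.eq_of_le hβ ?_
  rintro (x | x) y hxy
  · by_cases hx : x ∈ Set.range f
    · obtain ⟨j, rfl⟩ := hx
      exact hlr j y hxy
    · exact main (Sum.inl ⟨x, hx⟩) y hxy
  · exact β.trans' (β.symm' (hfβ x)) (hlr x y (α.trans' (hfα x) hxy))

theorem card_extension (f : B ↪ A) :
    Nat.card {α : Setoid (A ⊕ B) // IsBrauer α ∧ ∀ j, α (Sum.inl (f j)) (Sum.inr j)} =
      Nat.card {s : Setoid ({a // a ∉ Set.range f} ⊕ Empty) // IsBrauer s} := by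
  refine Nat.card_congr (Equiv.ofBijective
    (fun α => ⟨α.1.comap (coRange f), α.2.1.comap_coRange α.2.2⟩) ⟨fun α β h => ?_, fun s => ?_⟩)
  · exact Subtype.ext (α.2.1.eq_of_comap_coRange β.2.1 α.2.2 β.2.2 (Subtype.ext_iff.1 h))
  · obtain ⟨α, h1, h2, h3⟩ := exists_extension f s.2
    exact ⟨⟨α, h1, h2⟩, Subtype.ext h3⟩

end Diagram

/-! ### The number of frames. -/

namespace Brauer

variable {m q : ℕ}

/-- The number of Brauer partitions in `B_{mq}` of full rank `q`. -/
theorem card_isFrame (h : q ≤ m) (hqm : q ≡ m [MOD 2]) :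
    Nat.card {X : Brauer m q // IsFrame X} =
      m.choose q * predDoubleFactorial (m - q) * q ! := by
  classical
  have hfib : ∀ f : Fin q ↪ Fin m, Nat.card {α : Setoid (Fin m ⊕ Fin q) //
      Diagram.IsBrauer α ∧ ∀ j, α (Sum.inl (f j)) (Sum.inr j)} =
        predDoubleFactorial (m - q) := by
    intro f
    have hc : Fintype.card {a // a ∉ Set.range f} + Fintype.card Empty = m - q := by
      rw [Fintype.card_subtype_compl, Fintype.card_fin, Fintype.card_empty, add_zero,
        ← Nat.card_eq_fintype_card (α := {a // a ∈ Set.range f})]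
      congr 1
      exact (Nat.card_range_of_injective f.injective).trans (by simp)
    rw [Diagram.card_extension, Diagram.card_isBrauer, hc]
    rw [hc, Nat.even_sub h, Nat.even_iff, Nat.even_iff, hqm]
  -- A frame is an injection of the lower vertices into the upper ones together with a perfect
  -- matching of the m - q upper vertices left over.
  have hsig : Nat.card {X : Brauer m q // IsFrame X} = Nat.card (Σ f : Fin q ↪ Fin m,
      {α : Setoid (Fin m ⊕ Fin q) //
        Diagram.IsBrauer α ∧ ∀ j, α (Sum.inl (f j)) (Sum.inr j)}) := by
    symm
    refine Nat.card_congr (Equiv.ofBijective (fun p => ⟨⟨p.2.1, p.2.2.1⟩,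
      isFrame_of_exists_rel fun j => ⟨p.1 j, p.2.2.2 j⟩⟩) ⟨?_, ?_⟩)
    · rintro ⟨f, α, hα, hfα⟩ ⟨g, β, hβ, hgβ⟩ e
      have e' : α = β := congrArg (fun X => X.1.1) e
      subst e'
      have : f = g := by
        ext j
        exact congrArg Fin.val (Sum.inl_injective (hα.eq_of_rel (α.symm' (hfα j))
          (α.symm' (hgβ j)) (by simp) (by simp)))
      subst this
      rfl
    · rintro ⟨X, hX⟩
      obtain ⟨f, hf⟩ := hX.exists_embedding
      exact ⟨⟨f, X.1, X.2, hf⟩, rfl⟩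
  have : ∀ f : Fin q ↪ Fin m, Finite {α : Setoid (Fin m ⊕ Fin q) //
      Diagram.IsBrauer α ∧ ∀ j, α (Sum.inl (f j)) (Sum.inr j)} := fun f =>
    Finite.of_injective (β := Brauer m q) (fun α => ⟨α.1, α.2.1⟩) fun α β h =>
      Subtype.ext (congrArg (fun γ : Brauer m q => γ.1) h)
  rw [hsig, Nat.card_sigma, Finset.sum_congr rfl fun f _ => hfib f, Finset.sum_const, smul_eq_mul,
    Finset.card_univ, Fintype.card_embedding_eq, Fintype.card_fin, Fintype.card_fin,
    Nat.descFactorial_eq_factorial_mul_choose]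
  ring

/-- Brauer partitions of full rank exist. -/
theorem exists_isFrame (h : q ≤ m) (hqm : q ≡ m [MOD 2]) : ∃ X : Brauer m q, IsFrame X := by
  have : Nat.card {X : Brauer m q // IsFrame X} ≠ 0 := by
    rw [card_isFrame h hqm]
    exact (Nat.mul_pos (Nat.mul_pos (Nat.choose_pos h) (Nat.doubleFactorial_pos _))
      (Nat.factorial_pos q)).ne'
  obtain ⟨⟨X, hX⟩⟩ := (Nat.card_ne_zero.1 this).1
  exact ⟨X, hX⟩

end Brauer

/-- If the fibres of `F` are the orbits of a free action of `G`, then the image of `F` has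
`|V| / |G|` elements. -/
theorem card_eq_ncard_range_mul {V W G : Type} [Finite V] (act : V → G → V)
    (hfree : ∀ v, Function.Injective (act v)) (F : V → W)
    (hF : ∀ v v', F v = F v' ↔ ∃ g, v' = act v g) :
    Nat.card V = (Set.range F).ncard * Nat.card G := by
  have hfin : Finite (Set.range F) := inferInstance
  have := Fintype.ofFinite (Set.range F)
  have hfib : ∀ w : Set.range F, Nat.card {v : V // Set.rangeFactorization F v = w} = Nat.card G := by
    rintro ⟨_, v, rfl⟩
    symm
    refine Nat.card_congr (Equiv.ofBijective
      (fun g => ⟨act v g, Subtype.ext ((hF _ _).2 ⟨g, rfl⟩).symm⟩)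
      ⟨fun g g' h => hfree v (Subtype.ext_iff.1 h), ?_⟩)
    rintro ⟨v', hv'⟩
    obtain ⟨g, rfl⟩ := (hF v v').1 (congrArg Subtype.val hv').symm
    exact ⟨g, rfl⟩
  rw [Nat.card_congr (Equiv.sigmaFiberEquiv (Set.rangeFactorization F)).symm, Nat.card_sigma,
    Finset.sum_congr rfl fun w _ => hfib w, Finset.sum_const, smul_eq_mul, Finset.card_univ,
    ← Nat.card_eq_fintype_card]
  rfl

/-! ### Sandwich semigroups in coordinates -/

theorem setOf_rel_eq_iff {X : Type} (K : Setoid X) {y z : X} :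
    {x | K x y} = {x | K x z} ↔ K y z := by
  constructor
  · intro h
    have : y ∈ {x | K x y} := K.refl' y
    rw [h] at this
    exact this
  · intro h
    ext x
    exact ⟨fun k => K.trans' k h, fun k => K.trans' k (K.symm' h)⟩

theorem IsSubsetIsomorphicTo.isGroupSubset {S : Type} [Semigroup S] {X : Set S} {G : Type} [Group G]
    (h : IsSubsetIsomorphicTo X G) : IsGroupSubset X := by
  obtain ⟨f, -, rfl⟩ := h
  refine ⟨?_, f 1, ⟨1, rfl⟩, ?_, ?_⟩
  · rintro _ ⟨x, rfl⟩ _ ⟨y, rfl⟩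
    exact ⟨x * y, map_mul f x y⟩
  · rintro _ ⟨x, rfl⟩
    rw [← map_mul, ← map_mul, one_mul, mul_one]
    exact ⟨rfl, rfl⟩
  · rintro _ ⟨x, rfl⟩
    refine ⟨f x⁻¹, ⟨_, rfl⟩, ?_⟩
    rw [← map_mul, ← map_mul, mul_inv_cancel, inv_mul_cancel]
    exact ⟨rfl, rfl⟩

namespace Sandwich

open Brauer

variable {m n r q : ℕ} {σ : Brauer n m}

instance : Finite (Sandwich σ) := inferInstanceAs (Finite (Brauer m n))

/-- An element of the sandwich semigroup as a Brauer partition. -/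
def val (α : Sandwich σ) : Brauer m n := α

/-- A Brauer partition as an element of the sandwich semigroup. -/
def of (σ : Brauer n m) (α : Brauer m n) : Sandwich σ := α

theorem val_of (α : Brauer m n) : (of σ α).val = α := rfl

theorem val_mul (α β : Sandwich σ) : (α * β).val = α.val.comp (σ.comp β.val) :=
  Brauer.comp_assoc α.val σ β.val

theorem val_inj {α β : Sandwich σ} : α.val = β.val ↔ α = β := Iff.rfl

/-- The element `X Y*` of the sandwich semigroup. -/
def ofFrames (σ : Brauer n m) (X : Brauer m q) (Y : Brauer n q) : Sandwich σ :=
  of σ (X.comp Y.star)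

theorem val_ofFrames (X : Brauer m q) (Y : Brauer n q) : (ofFrames σ X Y).val = X.comp Y.star :=
  rfl

/-- The equation (σX)*(σX) = 1, expanded and bracketed to the right so that it can rewrite products
normalized by `comp_assoc`. -/
theorem upper_cancel {X : Brauer m q} (hX : IsFrame (σ.comp X)) {k : ℕ} (Z : Brauer q k) :
    X.star.comp (σ.star.comp (σ.comp (X.comp Z))) = Z := by
  have := hX.cancel Z
  rwa [star_comp, comp_assoc, comp_assoc] at this

theorem lower_cancel {Y : Brauer n q} (hY : IsFrame (σ.star.comp Y)) {k : ℕ} (Z : Brauer q k) :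
    Y.star.comp (σ.comp (σ.star.comp (Y.comp Z))) = Z := by
  have := hY.cancel Z
  rwa [star_comp, Brauer.star_star, comp_assoc, comp_assoc] at this

theorem ofFrames_mul_ofFrames (X X' : Brauer m q) (Y Y' : Brauer n q) :
    (ofFrames σ X Y * ofFrames σ X' Y').val =
      X.comp ((Y.star.comp (σ.comp X')).comp Y'.star) := by
  simp only [val_mul, val_ofFrames, comp_assoc]

theorem ofFrames_eq_iff {X X' : Brauer m q} {Y Y' : Brauer n q} (hX : IsFrame X)
    (hX' : IsFrame X') (hY' : IsFrame Y') :
    ofFrames σ X Y = ofFrames σ X' Y' ↔ ∃ π, X' = X.comp (perm π) ∧ Y' = Y.comp (perm π) :=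
  comp_star_eq_iff hX hX' hY'

/-- A permutation on the lower frame can be moved to the upper one, so a single permutation
coordinate suffices. -/
theorem ofFrames_comp_perm (X : Brauer m q) (Y : Brauer n q) (π ρ : Equiv.Perm (Fin q)) :
    ofFrames σ (X.comp (perm π)) (Y.comp (perm ρ)) = ofFrames σ (X.comp (perm (π * ρ⁻¹))) Y := by
  rw [← val_inj]
  simp only [val_ofFrames, star_comp, perm_star, ← perm_comp_perm, comp_assoc]

/-- The regular elements of rank `q` in coordinates. -/
theorem mem_D_iff {α : Sandwich σ} : α ∈ D σ q ↔ ∃ (X : Brauer m q) (Y : Brauer n q),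
    IsFrame (σ.comp X) ∧ IsFrame (σ.star.comp Y) ∧ α = ofFrames σ X Y := by
  constructor
  · rintro ⟨⟨a, ha⟩, hrank⟩
    obtain ⟨X, Y, hX, hY, hα⟩ := exists_frames α.val hrank
    replace ha : α.val = α.val.comp (σ.comp (a.val.comp (σ.comp α.val))) := by
      conv_lhs => rw [ha]
      simp only [val_mul, comp_assoc]
    -- The equation α = α σ a σ α factors α through σX, and likewise through Y* σ in `h2`; so
    -- neither of these has rank below q.
    have h1 : α.val = (α.val.comp (σ.comp (a.val))).comp ((σ.comp X).comp Y.star) := by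
      rw [comp_assoc σ X, ← hα]
      simpa only [comp_assoc] using ha
    have h2 : α.val = X.comp ((Y.star.comp σ).comp (a.val.comp (σ.comp α.val))) := by
      rw [comp_assoc, ← comp_assoc X, ← hα]
      exact ha
    have h3 : q ≤ α.val.rank := hrank.ge
    refine ⟨X, Y, isFrame_iff.2 ?_, isFrame_iff.2 ?_, hα⟩
    · rw [h1] at h3
      exact h3.trans ((rank_comp_le_right _ _).trans (rank_comp_le_left _ _))
    · rw [← rank_star, star_comp, Brauer.star_star]
      rw [h2] at h3
      exact h3.trans ((rank_comp_le_right _ _).trans (rank_comp_le_left _ _))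
  · rintro ⟨X, Y, hX, hY, rfl⟩
    -- The inverse σ* Y X* σ* works because Y* σ σ* Y = 1 and X* σ* σ X = 1.
    refine ⟨⟨of σ (σ.star.comp (Y.comp (X.star.comp σ.star))), ?_⟩,
      (isFrame_of_comp hX).rank_comp_star (isFrame_of_comp hY)⟩
    rw [← val_inj]
    simp only [val_mul, val_ofFrames, val_of, comp_assoc]
    rw [lower_cancel hY, upper_cancel hX]

theorem ofFrames_mem_D {X : Brauer m q} {Y : Brauer n q} (hX : IsFrame (σ.comp X))
    (hY : IsFrame (σ.star.comp Y)) : ofFrames σ X Y ∈ D σ q :=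
  mem_D_iff.2 ⟨X, Y, hX, hY, rfl⟩

theorem isFrame_comp_perm {k : ℕ} {α : Brauer k m} {X : Brauer m q} (h : IsFrame (α.comp X))
    (π : Equiv.Perm (Fin q)) : IsFrame (α.comp (X.comp (perm π))) := by
  rw [← comp_assoc]
  exact h.comp_perm π

/-! #### Green's relations -/

theorem mul_right_eq {X : Brauer m q} {Y Y' : Brauer n q} (hY : IsFrame (σ.star.comp Y))
    (π : Equiv.Perm (Fin q)) : ∃ u : Sandwich σ,
      ofFrames σ (X.comp (perm π)) Y' = ofFrames σ X Y * u := by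
  refine ⟨of σ (σ.star.comp (Y.comp ((perm π).comp Y'.star))), ?_⟩
  rw [← val_inj]
  simp only [val_mul, val_ofFrames, val_of, comp_assoc]
  rw [lower_cancel hY]

theorem mul_left_eq {X X' : Brauer m q} {Y : Brauer n q} (hX : IsFrame (σ.comp X))
    (π : Equiv.Perm (Fin q)) : ∃ u : Sandwich σ,
      ofFrames σ X' (Y.comp (perm π)) = u * ofFrames σ X Y := by
  refine ⟨of σ (X'.comp ((perm π).star.comp (X.star.comp σ.star))), ?_⟩
  rw [← val_inj]
  simp only [val_mul, val_ofFrames, val_of, comp_assoc, star_comp]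
  rw [upper_cancel hX]

/-- If X' Y'* is a right multiple of X Y*, cancelling Y'* leaves X' = X W, and W is a frame in
B_{qq}, hence a permutation. Conversely σ* Y inverts Y* σ on the right, so X can be followed by
anything. -/
theorem greenR_ofFrames_iff {X X' : Brauer m q} {Y Y' : Brauer n q} (hX' : IsFrame X')
    (hY : IsFrame (σ.star.comp Y)) (hY' : IsFrame (σ.star.comp Y')) :
    greenR (Sandwich σ) (ofFrames σ X Y) (ofFrames σ X' Y') ↔ ∃ π, X' = X.comp (perm π) := by
  constructor
  · rintro ⟨-, h⟩
    obtain ⟨Z, hZ⟩ : ∃ Z : Brauer q n, X'.comp Y'.star = X.comp Z := by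
      rcases h with h | ⟨v, h⟩
      · exact ⟨_, h⟩
      · refine ⟨Y.star.comp (σ.comp v.val), (val_inj.2 h).trans ?_⟩
        simp only [val_mul, val_ofFrames, comp_assoc]
    have h1 : X' = X.comp (Z.comp Y') := by
      rw [← comp_assoc, ← hZ, comp_assoc, isFrame_of_comp hY', comp_one]
    obtain ⟨π, hπ⟩ := (isFrame_of_comp (h1 ▸ hX')).exists_perm
    exact ⟨π, hπ ▸ h1⟩
  · rintro ⟨π, rfl⟩
    refine ⟨Or.inr ?_, Or.inr (mul_right_eq hY π)⟩
    have := mul_right_eq (X := X.comp (perm π)) (Y' := Y) hY' π⁻¹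
    rwa [comp_perm_comp_perm, mul_inv_cancel, perm_one, comp_one] at this

theorem greenL_ofFrames_iff {X X' : Brauer m q} {Y Y' : Brauer n q} (hX : IsFrame (σ.comp X))
    (hX' : IsFrame (σ.comp X')) (hY' : IsFrame Y') :
    greenL (Sandwich σ) (ofFrames σ X Y) (ofFrames σ X' Y') ↔ ∃ π, Y' = Y.comp (perm π) := by
  constructor
  · rintro ⟨-, h⟩
    obtain ⟨Z, hZ⟩ : ∃ Z : Brauer m q, X'.comp Y'.star = Z.comp Y.star := by
      rcases h with h | ⟨v, h⟩
      · exact ⟨_, h⟩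
      · refine ⟨v.val.comp (σ.comp X), (val_inj.2 h).trans ?_⟩
        simp only [val_mul, val_ofFrames, comp_assoc]
    have h1 : Y' = Y.comp (Z.star.comp X') := by
      have h2 := congrArg Brauer.star hZ
      simp only [star_comp, Brauer.star_star] at h2
      rw [← comp_assoc, ← h2, comp_assoc, isFrame_of_comp hX', comp_one]
    obtain ⟨π, hπ⟩ := (isFrame_of_comp (h1 ▸ hY')).exists_perm
    exact ⟨π, hπ ▸ h1⟩
  · rintro ⟨π, rfl⟩
    refine ⟨Or.inr ?_, Or.inr (mul_left_eq hX π)⟩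
    have := mul_left_eq (X' := X) (Y := Y.comp (perm π)) hX' π⁻¹
    rwa [comp_perm_comp_perm, mul_inv_cancel, perm_one, comp_one] at this

theorem greenH_ofFrames_iff {X X' : Brauer m q} {Y Y' : Brauer n q} (hX : IsFrame (σ.comp X))
    (hX' : IsFrame (σ.comp X')) (hY : IsFrame (σ.star.comp Y)) (hY' : IsFrame (σ.star.comp Y')) :
    greenH (Sandwich σ) (ofFrames σ X Y) (ofFrames σ X' Y') ↔
      (∃ π, X' = X.comp (perm π)) ∧ ∃ ρ, Y' = Y.comp (perm ρ) := by
  rw [← greenR_ofFrames_iff (isFrame_of_comp hX') hY hY',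
    ← greenL_ofFrames_iff hX hX' (isFrame_of_comp hY')]
  rfl

/-- Mutual divisibility gives β rank q, so β = X' Y'*. Then X' = X π makes σX' a frame, while Y* = π
Y'* σ u forces Y'* σ to have rank q, which is the other half of regularity. -/
theorem mem_D_of_greenR {α β : Sandwich σ} (hα : α ∈ D σ q) (h : greenR (Sandwich σ) α β) :
    β ∈ D σ q := by
  obtain ⟨X, Y, hX, hY, rfl⟩ := mem_D_iff.1 hα
  obtain ⟨h1, h2⟩ := h
  rcases h1 with rfl | ⟨u, hu⟩
  · exact hα
  rcases h2 with rfl | ⟨v, hv⟩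
  · exact hα
  have hv' : β.val = X.comp (Y.star.comp (σ.comp v.val)) := by
    rw [hv]
    simp only [val_mul, val_ofFrames, comp_assoc]
  have hu' : X.comp Y.star = β.val.comp (σ.comp u.val) := by
    rw [← val_mul, ← hu, val_ofFrames]
  have hrank : (X.comp Y.star).rank = q :=
    (isFrame_of_comp hX).rank_comp_star (isFrame_of_comp hY)
  have hβ : β.val.rank = q := by
    apply le_antisymm
    · rw [hv']
      exact (rank_comp_le_left _ _).trans (rank_le_right X)
    · rw [← hrank, hu']
      exact rank_comp_le_left _ _
  obtain ⟨X', Y', hX', hY', hβ'⟩ := exists_frames β.val hβ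
  have h1 : X' = X.comp (Y.star.comp (σ.comp (v.val.comp Y'))) := by
    have : X' = (X'.comp Y'.star).comp Y' := by rw [comp_assoc, hY', comp_one]
    rw [this, ← hβ', hv']
    simp only [comp_assoc]
  obtain ⟨π, hπ⟩ := (isFrame_of_comp (h1 ▸ hX')).exists_perm
  rw [hπ] at h1
  have h2 : Y.star = ((perm π).comp (Y'.star.comp σ)).comp u.val := by
    apply (isFrame_of_comp hX).left_cancel
    rw [hu', hβ', h1]
    simp only [comp_assoc]
  refine mem_D_iff.2 ⟨X', Y', ?_, ?_, hβ'⟩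
  · rw [h1]
    exact isFrame_comp_perm hX π
  · rw [isFrame_iff, ← rank_star, star_comp, Brauer.star_star]
    have h3 : q ≤ Y.star.rank := by
      rw [rank_star]
      exact isFrame_iff.1 (isFrame_of_comp hY)
    rw [h2] at h3
    exact h3.trans ((rank_comp_le_left _ _).trans (rank_comp_le_right _ _))

theorem mem_D_of_greenL {α β : Sandwich σ} (hα : α ∈ D σ q) (h : greenL (Sandwich σ) α β) :
    β ∈ D σ q := by
  obtain ⟨X, Y, hX, hY, rfl⟩ := mem_D_iff.1 hα
  obtain ⟨h1, h2⟩ := h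
  rcases h1 with rfl | ⟨u, hu⟩
  · exact hα
  rcases h2 with rfl | ⟨v, hv⟩
  · exact hα
  have hv' : β.val = (v.val.comp (σ.comp X)).comp Y.star := by
    rw [hv]
    simp only [val_mul, val_ofFrames, comp_assoc]
  have hu' : X.comp Y.star = (u.val.comp σ).comp β.val := by
    rw [comp_assoc, ← val_mul, ← hu, val_ofFrames]
  have hrank : (X.comp Y.star).rank = q :=
    (isFrame_of_comp hX).rank_comp_star (isFrame_of_comp hY)
  have hβ : β.val.rank = q := by
    apply le_antisymm
    · rw [hv', ← rank_star, star_comp, Brauer.star_star]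
      exact (rank_comp_le_left _ _).trans (rank_le_right Y)
    · rw [← hrank, hu']
      exact rank_comp_le_right _ _
  obtain ⟨X', Y', hX', hY', hβ'⟩ := exists_frames β.val hβ
  have h1 : Y' = Y.comp ((v.val.comp (σ.comp X)).star.comp X') := by
    have : Y' = (X'.comp Y'.star).star.comp X' := by
      rw [star_comp, Brauer.star_star, comp_assoc, hX', comp_one]
    rw [this, ← hβ', hv', star_comp, Brauer.star_star, comp_assoc]
  obtain ⟨π, hπ⟩ := (isFrame_of_comp (h1 ▸ hY')).exists_perm
  rw [hπ] at h1
  have h2 : X = (u.val.comp (σ.comp X')).comp ((perm π).star) := by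
    have h3 : X = (X.comp Y.star).comp Y := by
      rw [comp_assoc, isFrame_of_comp hY, comp_one]
    rw [h3, hu', hβ', h1]
    simp only [comp_assoc, star_comp]
    rw [isFrame_of_comp hY, comp_one]
  refine mem_D_iff.2 ⟨X', Y', ?_, ?_, hβ'⟩
  · rw [isFrame_iff]
    have h3 : q ≤ X.rank := isFrame_iff.1 (isFrame_of_comp hX)
    rw [h2] at h3
    exact h3.trans ((rank_comp_le_left _ _).trans (rank_comp_le_right _ _))
  · rw [h1]
    exact isFrame_comp_perm hY π

theorem mem_D_of_greenH {α β : Sandwich σ} (hα : α ∈ D σ q) (h : greenH (Sandwich σ) α β) :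
    β ∈ D σ q := mem_D_of_greenR hα h.1

theorem D_mem_classes {X₀ : Brauer m q} {Y₀ : Brauer n q} (hX₀ : IsFrame (σ.comp X₀))
    (hY₀ : IsFrame (σ.star.comp Y₀)) : D σ q ∈ (greenD (Sandwich σ)).classes := by
  refine ⟨ofFrames σ X₀ Y₀, ?_⟩
  -- Membership in D_q is invariant under R and under L, hence under their join. Conversely, X Y* is
  -- linked to X₀ Y₀* through X Y₀*.
  have hle : greenD (Sandwich σ) ≤ Setoid.ker (· ∈ D σ q) := by
    refine sup_le ?_ ?_
    · intro x y h
      exact propext ⟨fun hx => mem_D_of_greenR hx h,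
        fun hy => mem_D_of_greenR hy ((greenR _).symm' h)⟩
    · intro x y h
      exact propext ⟨fun hx => mem_D_of_greenL hx h,
        fun hy => mem_D_of_greenL hy ((greenL _).symm' h)⟩
  ext α
  constructor
  · intro hα
    obtain ⟨X, Y, hX, hY, rfl⟩ := mem_D_iff.1 hα
    have h1 : greenR (Sandwich σ) (ofFrames σ X Y) (ofFrames σ X Y₀) :=
      (greenR_ofFrames_iff (isFrame_of_comp hX) hY hY₀).2
        ⟨1, by rw [perm_one, comp_one]⟩
    have h2 : greenL (Sandwich σ) (ofFrames σ X Y₀) (ofFrames σ X₀ Y₀) :=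
      (greenL_ofFrames_iff hX hX₀ (isFrame_of_comp hY₀)).2
        ⟨1, by rw [perm_one, comp_one]⟩
    exact (greenD _).trans' ((le_sup_left : greenR (Sandwich σ) ≤ greenD _) h1)
      ((le_sup_right : greenL (Sandwich σ) ≤ greenD _) h2)
  · intro h
    exact (iff_of_eq (hle h)).2 (ofFrames_mem_D hX₀ hY₀)

/-! #### The `H`-classes -/

theorem classOf_greenH {X : Brauer m q} {Y : Brauer n q} (hX : IsFrame (σ.comp X))
    (hY : IsFrame (σ.star.comp Y)) : classOf (greenH (Sandwich σ)) (ofFrames σ X Y) =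
      Set.range fun π => ofFrames σ (X.comp (perm π)) Y := by
  ext β
  constructor
  · intro h
    obtain ⟨X', Y', hX', hY', rfl⟩ := mem_D_iff.1 (mem_D_of_greenH (ofFrames_mem_D hX hY) h)
    obtain ⟨⟨π, rfl⟩, ρ, rfl⟩ := (greenH_ofFrames_iff hX hX' hY hY').1 h
    exact ⟨π * ρ⁻¹, (ofFrames_comp_perm X Y π ρ).symm⟩
  · rintro ⟨π, rfl⟩
    exact (greenH_ofFrames_iff hX (isFrame_comp_perm hX π) hY hY).2
      ⟨⟨π, rfl⟩, 1, by rw [perm_one, comp_one]⟩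

theorem ofFrames_comp_perm_injective {X : Brauer m q} {Y : Brauer n q} (hX : IsFrame X)
    (hY : IsFrame Y) : Function.Injective fun π => ofFrames σ (X.comp (perm π)) Y := by
  intro π ρ h
  obtain ⟨θ, h1, h2⟩ := (ofFrames_eq_iff (hX.comp_perm π) (hX.comp_perm ρ) hY).1 h
  have hθ : (1 : Equiv.Perm (Fin q)) = θ :=
    hY.perm_eq (by rw [perm_one, comp_one]; exact h2)
  rw [← hθ, perm_one, comp_one] at h1
  exact (hX.perm_eq h1).symm

theorem ncard_classOf_greenH {X : Brauer m q} {Y : Brauer n q} (hX : IsFrame (σ.comp X))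
    (hY : IsFrame (σ.star.comp Y)) :
    (classOf (greenH (Sandwich σ)) (ofFrames σ X Y)).ncard = q ! := by
  rw [classOf_greenH hX hY, ← Set.image_univ, Set.ncard_image_of_injective _
    (ofFrames_comp_perm_injective (isFrame_of_comp hX) (isFrame_of_comp hY)), Set.ncard_univ,
    Nat.card_perm, Nat.card_eq_fintype_card, Fintype.card_fin]

/-- Closure under squaring is enough: X (Y* σ X) Y* lies in X S_q Y*, and both outer factors cancel.
-/
theorem isFrame_of_isGroupSubset {X : Brauer m q} {Y : Brauer n q} (hX : IsFrame (σ.comp X))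
    (hY : IsFrame (σ.star.comp Y))
    (h : IsGroupSubset (classOf (greenH (Sandwich σ)) (ofFrames σ X Y))) :
    IsFrame (Y.star.comp (σ.comp X)) := by
  have hmem : ofFrames σ X Y ∈ classOf (greenH (Sandwich σ)) (ofFrames σ X Y) :=
    (greenH (Sandwich σ)).refl' _
  have h2 := h.1 _ hmem _ hmem
  rw [classOf_greenH hX hY] at h2
  obtain ⟨π, hπ⟩ := h2
  rw [← val_inj, ofFrames_mul_ofFrames] at hπ
  simp only [val_ofFrames, comp_assoc X] at hπ
  have h3 := congrArg (fun α : Brauer q n => α.comp Y) ((isFrame_of_comp hX).left_cancel hπ)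
  simp only [comp_assoc _ Y.star Y] at h3
  rw [isFrame_of_comp hY, comp_one, comp_one] at h3
  rw [← h3]
  exact isFrame_perm π

/-- The factor g = Y* σ X' appears between the two elements; the shift by g⁻¹ absorbs it and makes
the permutation coordinate multiplicative. -/
theorem ofFrames_comp_perm_mul {X X' : Brauer m q} {Y Y' : Brauer n q} {g : Equiv.Perm (Fin q)}
    (hg : Y.star.comp (σ.comp X') = perm g) (π ρ : Equiv.Perm (Fin q)) :
    ofFrames σ (X.comp (perm (π * g⁻¹))) Y * ofFrames σ (X'.comp (perm (ρ * g⁻¹))) Y' =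
      ofFrames σ (X.comp (perm (π * ρ * g⁻¹))) Y' := by
  rw [← val_inj, ofFrames_mul_ofFrames, ← comp_assoc σ, ← comp_assoc Y.star, hg, perm_comp_perm,
    val_ofFrames, comp_assoc, comp_assoc, ← comp_assoc (perm _) (perm _), perm_comp_perm]
  simp only [mul_assoc, inv_mul_cancel_left]

theorem isSubsetIsomorphicTo_perm {X : Brauer m q} {Y : Brauer n q} (hX : IsFrame (σ.comp X))
    (hY : IsFrame (σ.star.comp Y)) (h : IsFrame (Y.star.comp (σ.comp X))) :
    IsSubsetIsomorphicTo (classOf (greenH (Sandwich σ)) (ofFrames σ X Y))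
      (Equiv.Perm (Fin q)) := by
  obtain ⟨g, hg⟩ := h.exists_perm
  refine ⟨⟨fun π => ofFrames σ (X.comp (perm (π * g⁻¹))) Y, fun π ρ => ?_⟩, ?_, ?_⟩
  · exact (ofFrames_comp_perm_mul hg π ρ).symm
  · intro π ρ e
    exact mul_right_cancel
      (ofFrames_comp_perm_injective (isFrame_of_comp hX) (isFrame_of_comp hY) e)
  · rw [classOf_greenH hX hY]
    ext β
    constructor
    · rintro ⟨π, rfl⟩
      exact ⟨π * g⁻¹, rfl⟩
    · rintro ⟨π, rfl⟩
      refine ⟨π * g, ?_⟩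
      change ofFrames σ (X.comp (perm (π * g * g⁻¹))) Y = _
      rw [mul_inv_cancel_right]

theorem isGroupSubset_iff {X : Brauer m q} {Y : Brauer n q} (hX : IsFrame (σ.comp X))
    (hY : IsFrame (σ.star.comp Y)) :
    IsGroupSubset (classOf (greenH (Sandwich σ)) (ofFrames σ X Y)) ↔
      IsFrame (Y.star.comp (σ.comp X)) :=
  ⟨isFrame_of_isGroupSubset hX hY, fun h => (isSubsetIsomorphicTo_perm hX hY h).isGroupSubset⟩

end Sandwich

/-! ### The Brauer monoid as a sandwich semigroup. -/

namespace Brauer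

/-- The Brauer monoid as the sandwich semigroup of the identity. -/
theorem instSemigroup_eq (r : ℕ) : (inferInstance : Semigroup (Brauer r r)) =
    (inferInstance : Semigroup (Sandwich (one r))) := by
  apply Semigroup.ext
  funext α β
  change Brauer.comp α β = Brauer.comp (Brauer.comp α (one r)) β
  rw [comp_one]

theorem greenR_eq (r : ℕ) : greenR (Brauer r r) = greenR (Sandwich (one r)) :=
  congrArg (fun I => @greenR (Brauer r r) I) (instSemigroup_eq r)

theorem greenL_eq (r : ℕ) : greenL (Brauer r r) = greenL (Sandwich (one r)) :=
  congrArg (fun I => @greenL (Brauer r r) I) (instSemigroup_eq r)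

theorem greenH_eq (r : ℕ) : greenH (Brauer r r) = greenH (Sandwich (one r)) :=
  congrArg (fun I => @greenH (Brauer r r) I) (instSemigroup_eq r)

theorem isGroupSubset_eq (r : ℕ) (X : Set (Brauer r r)) :
    IsGroupSubset X = @IsGroupSubset (Sandwich (one r)) _ X :=
  congrArg (fun I => @IsGroupSubset (Brauer r r) I X) (instSemigroup_eq r)

end Brauer

/-! ### The map bar in coordinates. -/

namespace Sandwich

open Brauer

variable {m n r q : ℕ} {σ : Brauer n m} (e : Fin r ≃ Diagram.transversals σ.1)

theorem isFrame_tau_comp_star : IsFrame ((σ.tau e).comp σ).star := by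
  have h : (σ.tau e).comp (σ.tau e).star = one r := by
    have := isFrame_tau_star σ e
    rwa [IsFrame, Brauer.star_star] at this
  rw [IsFrame, Brauer.star_star, star_comp, comp_assoc, ← comp_assoc σ, ← tau_star_comp σ e,
    comp_assoc, h, comp_one, h]

/-- Since τ* τ = σ σ* and σ σ* σ = σ, the partitions τσX and σX have the same product with their
reflections: X* σ* σ σ* σ X = X* σ* σ X. -/
theorem isFrame_upper_iff {X : Brauer m q} :
    IsFrame (((σ.tau e).comp σ).comp X) ↔ IsFrame (σ.comp X) := by
  rw [comp_assoc]
  refine ⟨isFrame_of_comp, fun h => ?_⟩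
  have h1 : σ.comp (σ.star.comp (σ.comp X)) = σ.comp X := by
    rw [← comp_assoc σ.star, ← comp_assoc, comp_star_comp]
  rw [IsFrame, star_comp, comp_assoc, ← comp_assoc (σ.tau e).star, tau_star_comp, comp_assoc, h1]
  exact h

theorem isFrame_lower_iff {Y : Brauer n q} :
    IsFrame ((σ.tau e).comp Y) ↔ IsFrame (σ.star.comp Y) := by
  rw [IsFrame, IsFrame, star_comp, star_comp, Brauer.star_star, comp_assoc, comp_assoc,
    ← comp_assoc (σ.tau e).star, tau_star_comp, comp_assoc]

/-- The image of an element in coordinates. -/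
theorem bar_ofFrames (X : Brauer m q) (Y : Brauer n q) : bar e (ofFrames σ X Y) =
    (ofFrames (one r) (((σ.tau e).comp σ).comp X) ((σ.tau e).comp Y)).val := by
  change (((σ.tau e).comp σ).comp (X.comp Y.star)).comp (σ.tau e).star = _
  simp only [val_ofFrames, star_comp, comp_assoc]

theorem bar_mem_D {α : Sandwich σ} (h : α ∈ D σ q) : of (one r) (bar e α) ∈ D (one r) q := by
  obtain ⟨X, Y, hX, hY, rfl⟩ := mem_D_iff.1 h
  rw [bar_ofFrames]
  refine ofFrames_mem_D ?_ ?_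
  · rwa [one_comp, isFrame_upper_iff]
  · rwa [Brauer.star_one, one_comp, isFrame_lower_iff]

/-- On regular elements bar preserves rank, so the rank of α can be read off from its image. -/
theorem mem_D_of_bar_mem {α : Sandwich σ} (hα : α ∈ regularElements (Sandwich σ))
    (h : of (one r) (bar e α) ∈ D (one r) q) : α ∈ D σ q := by
  have h1 : α ∈ D σ α.rank := ⟨hα, rfl⟩
  exact ⟨hα, (bar_mem_D e h1).2.symm.trans h.2⟩

theorem greenR_bar_iff {X X' : Brauer m q} {Y Y' : Brauer n q} (hX' : IsFrame (σ.comp X'))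
    (hY : IsFrame (σ.star.comp Y)) (hY' : IsFrame (σ.star.comp Y')) :
    greenR (Brauer r r) (bar e (ofFrames σ X Y)) (bar e (ofFrames σ X' Y')) ↔
      ∃ π, ((σ.tau e).comp σ).comp X' = (((σ.tau e).comp σ).comp X).comp (perm π) := by
  rw [bar_ofFrames, bar_ofFrames, greenR_eq]
  exact greenR_ofFrames_iff ((isFrame_upper_iff e).2 hX')
    (by rwa [Brauer.star_one, one_comp, isFrame_lower_iff])
    (by rwa [Brauer.star_one, one_comp, isFrame_lower_iff])

theorem greenL_bar_iff {X X' : Brauer m q} {Y Y' : Brauer n q} (hX : IsFrame (σ.comp X))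
    (hX' : IsFrame (σ.comp X')) (hY' : IsFrame (σ.star.comp Y')) :
    greenL (Brauer r r) (bar e (ofFrames σ X Y)) (bar e (ofFrames σ X' Y')) ↔
      ∃ π, (σ.tau e).comp Y' = ((σ.tau e).comp Y).comp (perm π) := by
  rw [bar_ofFrames, bar_ofFrames, greenL_eq]
  exact greenL_ofFrames_iff (by rwa [one_comp, isFrame_upper_iff])
    (by rwa [one_comp, isFrame_upper_iff]) ((isFrame_lower_iff e).2 hY')

theorem greenH_bar_iff {X X' : Brauer m q} {Y Y' : Brauer n q} (hX : IsFrame (σ.comp X))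
    (hX' : IsFrame (σ.comp X')) (hY : IsFrame (σ.star.comp Y)) (hY' : IsFrame (σ.star.comp Y')) :
    greenH (Brauer r r) (bar e (ofFrames σ X Y)) (bar e (ofFrames σ X' Y')) ↔
      (∃ π, ((σ.tau e).comp σ).comp X' = (((σ.tau e).comp σ).comp X).comp (perm π)) ∧
        ∃ π, (σ.tau e).comp Y' = ((σ.tau e).comp Y).comp (perm π) := by
  rw [← greenR_bar_iff e hX' hY hY', ← greenL_bar_iff e hX hX' hY']
  rfl

/-! #### The classes induced from the Brauer monoid -/

theorem hatClass_greenR_subset {α : Sandwich σ} (hα : α ∈ D σ q) :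
    hatClass e (greenR (Brauer r r)) α ⊆ D σ q := by
  rintro β ⟨hβ, h⟩
  rw [greenR_eq] at h
  exact mem_D_of_bar_mem e hβ (mem_D_of_greenR (bar_mem_D e hα) h)

theorem hatClass_greenL_subset {α : Sandwich σ} (hα : α ∈ D σ q) :
    hatClass e (greenL (Brauer r r)) α ⊆ D σ q := by
  rintro β ⟨hβ, h⟩
  rw [greenL_eq] at h
  exact mem_D_of_bar_mem e hβ (mem_D_of_greenL (bar_mem_D e hα) h)

theorem hatClass_greenH_subset {α : Sandwich σ} (hα : α ∈ D σ q) :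
    hatClass e (greenH (Brauer r r)) α ⊆ D σ q :=
  fun _ hβ => hatClass_greenR_subset e hα ⟨hβ.1, hβ.2.1⟩

theorem hatClass_eq_iff (K : Setoid (Brauer r r)) {α β : Sandwich σ}
    (hβ : β ∈ regularElements (Sandwich σ)) :
    hatClass e K α = hatClass e K β ↔ K (bar e α) (bar e β) := by
  constructor
  · intro h
    have : β ∈ hatClass e K β := ⟨hβ, K.refl' _⟩
    rw [← h] at this
    exact this.2
  · intro h
    ext γ
    exact and_congr_right fun _ => ⟨fun k => K.trans' (K.symm' h) k, fun k => K.trans' h k⟩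

/-- If the elements `E v` represent all classes of `D_q` under the relation induced by `K`, and two
of them are related exactly when their indices are in the same orbit of a free action of `G`, then
there are `|V| / |G|` such classes. -/
theorem card_eq_ncard_hatClasses_mul (K : Setoid (Brauer r r)) {V G : Type} [Finite V]
    (act : V → G → V) (hfree : ∀ v, Function.Injective (act v)) (E : V → Sandwich σ)
    (hE : ∀ v, E v ∈ D σ q) (hK : ∀ α ∈ D σ q, hatClass e K α ⊆ D σ q)
    (hrep : ∀ α ∈ D σ q, ∃ v, K (bar e (E v)) (bar e α))
    (horb : ∀ v v', K (bar e (E v)) (bar e (E v')) ↔ ∃ g, v' = act v g) :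
    Nat.card V =
      {X | X ∈ hatClasses e K ∧ X ⊆ D σ q}.ncard * Nat.card G := by
  have hset : {X | X ∈ hatClasses e K ∧ X ⊆ D σ q} = Set.range fun v => hatClass e K (E v) := by
    ext X
    constructor
    · rintro ⟨⟨α, hα, rfl⟩, hsub⟩
      obtain ⟨v, hv⟩ := hrep α (hsub ⟨hα, K.refl' _⟩)
      exact ⟨v, (hatClass_eq_iff e K hα).2 hv⟩
    · rintro ⟨v, rfl⟩
      exact ⟨⟨E v, (hE v).1, rfl⟩, hK _ (hE v)⟩
  rw [hset]
  exact card_eq_ncard_range_mul act hfree _ fun v v' =>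
    (hatClass_eq_iff e K (hE v').1).trans (horb v v')

/-- A lift of a frame along the upper contraction. -/
theorem upper_comp_lift (Z : Brauer r q) :
    ((σ.tau e).comp σ).comp (((σ.tau e).comp σ).star.comp Z) = Z := by
  have := (isFrame_tau_comp_star e).cancel Z
  rwa [Brauer.star_star] at this

/-- A lift of a frame along the lower contraction. -/
theorem lower_comp_lift (Z : Brauer r q) :
    (σ.tau e).comp ((σ.tau e).star.comp Z) = Z := by
  have := (isFrame_tau_star σ e).cancel Z
  rwa [Brauer.star_star] at this

theorem isFrame_upper_lift {Z : Brauer r q} (hZ : IsFrame Z) :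
    IsFrame (σ.comp (((σ.tau e).comp σ).star.comp Z)) := by
  rwa [← isFrame_upper_iff e, upper_comp_lift]

theorem isFrame_lower_lift {Z : Brauer r q} (hZ : IsFrame Z) :
    IsFrame (σ.star.comp ((σ.tau e).star.comp Z)) := by
  rwa [← isFrame_lower_iff e, lower_comp_lift]

/-- The right action of permutations on partitions of full rank. -/
def frameAct (X : {X : Brauer r q // IsFrame X}) (π : Equiv.Perm (Fin q)) :
    {X : Brauer r q // IsFrame X} := ⟨X.1.comp (perm π), X.2.comp_perm π⟩

theorem frameAct_injective (X : {X : Brauer r q // IsFrame X}) :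
    Function.Injective (frameAct X) :=
  fun _ _ h => X.2.perm_eq (congrArg Subtype.val h)

/-- A hat R-class is determined by the S_q-orbit of the frame τσX in B_{rq}, and each frame Z
occurs, as the image of (τσ)* Z. The action is free, so the count is the number of frames divided by
q!. -/
theorem ncard_hatClasses_greenR (hq : q ≤ r) (hqr : q ≡ r [MOD 2]) :
    {X | X ∈ hatClasses e (greenR (Brauer r r)) ∧ X ⊆ D σ q}.ncard =
      r.choose q * predDoubleFactorial (r - q) := by
  obtain ⟨Z₀, hZ₀⟩ := exists_isFrame hq hqr
  have hY₀ := isFrame_lower_lift e hZ₀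
  have h := card_eq_ncard_hatClasses_mul (q := q) e (greenR (Brauer r r)) frameAct
    frameAct_injective
    (fun Z => ofFrames σ (((σ.tau e).comp σ).star.comp Z.1) ((σ.tau e).star.comp Z₀))
    (fun Z => ofFrames_mem_D (isFrame_upper_lift e Z.2) hY₀)
    (fun α hα => hatClass_greenR_subset e hα) ?_ ?_
  · rw [card_isFrame hq hqr, Nat.card_perm, Nat.card_eq_fintype_card, Fintype.card_fin] at h
    exact (Nat.eq_of_mul_eq_mul_right (Nat.factorial_pos q) h).symm
  · intro α hα
    obtain ⟨X, Y, hX, hY, rfl⟩ := mem_D_iff.1 hα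
    refine ⟨⟨_, (isFrame_upper_iff e).2 hX⟩, (greenR_bar_iff e hX hY₀ hY).2 ⟨1, ?_⟩⟩
    rw [upper_comp_lift, perm_one, comp_one]
  · intro Z Z'
    rw [greenR_bar_iff e (isFrame_upper_lift e Z'.2) hY₀ hY₀, upper_comp_lift, upper_comp_lift]
    exact exists_congr fun π => ⟨fun h => Subtype.ext h, fun h => congrArg Subtype.val h⟩

theorem ncard_hatClasses_greenL (hq : q ≤ r) (hqr : q ≡ r [MOD 2]) :
    {X | X ∈ hatClasses e (greenL (Brauer r r)) ∧ X ⊆ D σ q}.ncard =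
      r.choose q * predDoubleFactorial (r - q) := by
  obtain ⟨Z₀, hZ₀⟩ := exists_isFrame hq hqr
  have hX₀ := isFrame_upper_lift e hZ₀
  have h := card_eq_ncard_hatClasses_mul (q := q) e (greenL (Brauer r r)) frameAct
    frameAct_injective
    (fun Z => ofFrames σ (((σ.tau e).comp σ).star.comp Z₀) ((σ.tau e).star.comp Z.1))
    (fun Z => ofFrames_mem_D hX₀ (isFrame_lower_lift e Z.2))
    (fun α hα => hatClass_greenL_subset e hα) ?_ ?_
  · rw [card_isFrame hq hqr, Nat.card_perm, Nat.card_eq_fintype_card, Fintype.card_fin] at h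
    exact (Nat.eq_of_mul_eq_mul_right (Nat.factorial_pos q) h).symm
  · intro α hα
    obtain ⟨X, Y, hX, hY, rfl⟩ := mem_D_iff.1 hα
    refine ⟨⟨_, (isFrame_lower_iff e).2 hY⟩, (greenL_bar_iff e hX₀ hX hY).2 ⟨1, ?_⟩⟩
    rw [lower_comp_lift, perm_one, comp_one]
  · intro Z Z'
    rw [greenL_bar_iff e hX₀ hX₀ (isFrame_lower_lift e Z'.2), lower_comp_lift, lower_comp_lift]
    exact exists_congr fun π => ⟨fun h => Subtype.ext h, fun h => congrArg Subtype.val h⟩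

theorem ncard_hatClasses_greenH (hq : q ≤ r) (hqr : q ≡ r [MOD 2]) :
    {X | X ∈ hatClasses e (greenH (Brauer r r)) ∧ X ⊆ D σ q}.ncard =
      r.choose q ^ 2 * predDoubleFactorial (r - q) ^ 2 := by
  have h := card_eq_ncard_hatClasses_mul (q := q) e (greenH (Brauer r r))
    (V := {X : Brauer r q // IsFrame X} × {X : Brauer r q // IsFrame X})
    (G := Equiv.Perm (Fin q) × Equiv.Perm (Fin q))
    (fun Z π => (frameAct Z.1 π.1, frameAct Z.2 π.2))
    (fun Z π ρ h => Prod.ext (frameAct_injective _ (congrArg Prod.fst h))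
      (frameAct_injective _ (congrArg Prod.snd h)))
    (fun Z => ofFrames σ (((σ.tau e).comp σ).star.comp Z.1.1) ((σ.tau e).star.comp Z.2.1))
    (fun Z => ofFrames_mem_D (isFrame_upper_lift e Z.1.2) (isFrame_lower_lift e Z.2.2))
    (fun α hα => hatClass_greenH_subset e hα) ?_ ?_
  · rw [Nat.card_prod, Nat.card_prod, card_isFrame hq hqr, Nat.card_perm,
      Nat.card_eq_fintype_card, Fintype.card_fin] at h
    apply Nat.eq_of_mul_eq_mul_right (Nat.mul_pos (Nat.factorial_pos q) (Nat.factorial_pos q))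
    rw [← h]
    ring
  · intro α hα
    obtain ⟨X, Y, hX, hY, rfl⟩ := mem_D_iff.1 hα
    have hX' := (isFrame_upper_iff e).2 hX
    have hY' := (isFrame_lower_iff e).2 hY
    refine ⟨(⟨_, hX'⟩, ⟨_, hY'⟩), (greenH_bar_iff e (isFrame_upper_lift e hX') hX
      (isFrame_lower_lift e hY') hY).2 ⟨⟨1, ?_⟩, 1, ?_⟩⟩
    · rw [upper_comp_lift, perm_one, comp_one]
    · rw [lower_comp_lift, perm_one, comp_one]
  · intro Z Z'
    rw [greenH_bar_iff e (isFrame_upper_lift e Z.1.2) (isFrame_upper_lift e Z'.1.2)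
      (isFrame_lower_lift e Z.2.2) (isFrame_lower_lift e Z'.2.2), upper_comp_lift, upper_comp_lift,
      lower_comp_lift, lower_comp_lift]
    constructor
    · rintro ⟨⟨π, h1⟩, ρ, h2⟩
      exact ⟨(π, ρ), Prod.ext (Subtype.ext h1) (Subtype.ext h2)⟩
    · rintro ⟨⟨π, ρ⟩, h⟩
      exact ⟨⟨π, congrArg (fun W => W.1.1) h⟩, ρ, congrArg (fun W => W.2.1) h⟩

/-! #### The classes inside an induced class -/

theorem ncard_classes_of_bijective {S : Type} (K : Setoid S) (C : Set S) {V : Type} (E : V → S)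
    (hE : ∀ v x, K x (E v) → x ∈ C) (hrep : ∀ x ∈ C, ∃ v, K x (E v))
    (hinj : ∀ v v', K (E v) (E v') → v = v') :
    {Y | Y ∈ K.classes ∧ Y ⊆ C}.ncard = Nat.card V := by
  have hset : {Y | Y ∈ K.classes ∧ Y ⊆ C} = Set.range fun v => {x | K x (E v)} := by
    ext Y
    constructor
    · rintro ⟨⟨y, rfl⟩, hsub⟩
      obtain ⟨v, hv⟩ := hrep y (hsub (K.refl' y))
      exact ⟨v, ((setOf_rel_eq_iff K).2 hv).symm⟩
    · rintro ⟨v, rfl⟩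
      exact ⟨⟨E v, rfl⟩, fun x hx => hE v x hx⟩
  rw [hset, ← Set.image_univ, Set.ncard_image_of_injective _ fun v v' h =>
    hinj v v' ((setOf_rel_eq_iff K).1 h), Set.ncard_univ]

theorem isFrame_of_upper_eq {X X' : Brauer m q} (hX : IsFrame (σ.comp X))
    (h : ((σ.tau e).comp σ).comp X' = ((σ.tau e).comp σ).comp X) : IsFrame (σ.comp X') := by
  rwa [← isFrame_upper_iff e, h, isFrame_upper_iff]

theorem isFrame_of_lower_eq {Y Y' : Brauer n q} (hY : IsFrame (σ.star.comp Y))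
    (h : (σ.tau e).comp Y' = (σ.tau e).comp Y) : IsFrame (σ.star.comp Y') := by
  rwa [← isFrame_lower_iff e, h, isFrame_lower_iff]

/-- S_q acts freely on frames, so a permutation that relates two points of one fibre over a frame
fixes that frame and is trivial. -/
theorem eq_of_comp_eq {k : ℕ} {T : Brauer k m} {X X' Z : Brauer m q}
    (hZ : IsFrame (T.comp Z)) (h1 : T.comp X = T.comp Z) (h2 : T.comp X' = T.comp Z)
    {π : Equiv.Perm (Fin q)} (h : X' = X.comp (perm π)) : X = X' := by
  have h3 : T.comp Z = (T.comp Z).comp (perm π) := by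
    conv_lhs => rw [← h2, h, ← comp_assoc, h1]
  have h4 : (1 : Equiv.Perm (Fin q)) = π := by
    apply hZ.perm_eq
    rw [perm_one, comp_one]
    exact h3
  rw [h, ← h4, perm_one, comp_one]

theorem eq_of_comp_eq_comp_perm {k : ℕ} {T : Brauer k m} {X X' : Brauer m q}
    {π : Equiv.Perm (Fin q)} (h : T.comp X' = (T.comp X).comp (perm π)) :
    T.comp (X'.comp (perm π⁻¹)) = T.comp X := by
  rw [← comp_assoc, h, comp_perm_comp_perm, mul_inv_cancel, perm_one, comp_one]

/-- With Y fixed, the fibre of X' ↦ τσX' through X meets every R-class of the hat class exactly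
once. -/
theorem ncard_greenR_classes {X : Brauer m q} {Y : Brauer n q} (hX : IsFrame (σ.comp X))
    (hY : IsFrame (σ.star.comp Y)) :
    ({C | C ∈ (greenR (Sandwich σ)).classes ∧
        C ⊆ hatClass e (greenR (Brauer r r)) (ofFrames σ X Y)}.ncard : ℚ) =
      (predDoubleFactorial (m + q) : ℚ) / predDoubleFactorial (r + q) := by
  rw [← card_fibre (isFrame_tau_comp_star e) (((σ.tau e).comp σ).comp X)]
  congr 1
  refine ncard_classes_of_bijective _ _ (fun X' => ofFrames σ X'.1 Y) ?_ ?_ ?_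
  · intro X' β hβ
    have hX' := isFrame_of_upper_eq e hX X'.2
    have hD := mem_D_of_greenR (ofFrames_mem_D hX' hY) ((greenR _).symm' hβ)
    obtain ⟨X'', Y'', hX'', hY'', rfl⟩ := mem_D_iff.1 hD
    obtain ⟨π, rfl⟩ :=
      (greenR_ofFrames_iff (isFrame_of_comp hX'') hY hY'').1 ((greenR _).symm' hβ)
    refine ⟨hD.1, (greenR_bar_iff e hX'' hY hY'').2 ⟨π, ?_⟩⟩
    rw [← comp_assoc, X'.2]
  · intro β hβ
    have hD := hatClass_greenR_subset e (ofFrames_mem_D hX hY) hβ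
    obtain ⟨X', Y', hX', hY', rfl⟩ := mem_D_iff.1 hD
    obtain ⟨π, hπ⟩ := (greenR_bar_iff e hX' hY hY').1 hβ.2
    exact ⟨⟨X'.comp (perm π⁻¹), eq_of_comp_eq_comp_perm hπ⟩,
      (greenR_ofFrames_iff ((isFrame_of_comp hX').comp_perm _) hY' hY).2 ⟨π⁻¹, rfl⟩⟩
  · intro X₁ X₂ h
    obtain ⟨π, hπ⟩ := (greenR_ofFrames_iff
      (isFrame_of_comp (isFrame_of_upper_eq e hX X₂.2)) hY hY).1 h
    exact Subtype.ext (eq_of_comp_eq ((isFrame_upper_iff e).2 hX) X₁.2 X₂.2 hπ)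

theorem ncard_greenL_classes {X : Brauer m q} {Y : Brauer n q} (hX : IsFrame (σ.comp X))
    (hY : IsFrame (σ.star.comp Y)) :
    ({C | C ∈ (greenL (Sandwich σ)).classes ∧
        C ⊆ hatClass e (greenL (Brauer r r)) (ofFrames σ X Y)}.ncard : ℚ) =
      (predDoubleFactorial (n + q) : ℚ) / predDoubleFactorial (r + q) := by
  rw [← card_fibre (isFrame_tau_star σ e) ((σ.tau e).comp Y)]
  congr 1
  refine ncard_classes_of_bijective _ _ (fun Y' => ofFrames σ X Y'.1) ?_ ?_ ?_
  · intro Y' β hβ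
    have hY' := isFrame_of_lower_eq e hY Y'.2
    have hD := mem_D_of_greenL (ofFrames_mem_D hX hY') ((greenL _).symm' hβ)
    obtain ⟨X'', Y'', hX'', hY'', rfl⟩ := mem_D_iff.1 hD
    obtain ⟨π, rfl⟩ :=
      (greenL_ofFrames_iff hX hX'' (isFrame_of_comp hY'')).1 ((greenL _).symm' hβ)
    refine ⟨hD.1, (greenL_bar_iff e hX hX'' hY'').2 ⟨π, ?_⟩⟩
    rw [← comp_assoc, Y'.2]
  · intro β hβ
    have hD := hatClass_greenL_subset e (ofFrames_mem_D hX hY) hβ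
    obtain ⟨X', Y', hX', hY', rfl⟩ := mem_D_iff.1 hD
    obtain ⟨π, hπ⟩ := (greenL_bar_iff e hX hX' hY').1 hβ.2
    exact ⟨⟨Y'.comp (perm π⁻¹), eq_of_comp_eq_comp_perm hπ⟩,
      (greenL_ofFrames_iff hX' hX ((isFrame_of_comp hY').comp_perm _)).2 ⟨π⁻¹, rfl⟩⟩
  · intro Y₁ Y₂ h
    obtain ⟨π, hπ⟩ := (greenL_ofFrames_iff hX hX
      (isFrame_of_comp (isFrame_of_lower_eq e hY Y₂.2))).1 h
    exact Subtype.ext (eq_of_comp_eq ((isFrame_lower_iff e).2 hY) Y₁.2 Y₂.2 hπ)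

/-- The elements of an induced `H`-class in normalized coordinates. -/
theorem mem_hatClass_greenH_iff {X : Brauer m q} {Y : Brauer n q} (hX : IsFrame (σ.comp X))
    (hY : IsFrame (σ.star.comp Y)) (β : Sandwich σ) :
    β ∈ hatClass e (greenH (Brauer r r)) (ofFrames σ X Y) ↔
      ∃ X' Y', ((σ.tau e).comp σ).comp X' = ((σ.tau e).comp σ).comp X ∧
        (σ.tau e).comp Y' = (σ.tau e).comp Y ∧ ∃ π, β = ofFrames σ (X'.comp (perm π)) Y' := by
  constructor
  · intro hβ
    have hD := hatClass_greenH_subset e (ofFrames_mem_D hX hY) hβ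
    obtain ⟨X', Y', hX', hY', rfl⟩ := mem_D_iff.1 hD
    obtain ⟨⟨π, hπ⟩, ρ, hρ⟩ := (greenH_bar_iff e hX hX' hY hY').1 hβ.2
    -- X' π⁻¹ and Y' ρ⁻¹ lie in the chosen fibres. Applying π ρ⁻¹ to the former gives X' ρ⁻¹, and
    -- (X' ρ⁻¹)(Y' ρ⁻¹)* = X' Y'*.
    refine ⟨_, _, eq_of_comp_eq_comp_perm hπ, eq_of_comp_eq_comp_perm hρ, π * ρ⁻¹, ?_⟩
    rw [comp_perm_comp_perm, inv_mul_cancel_left]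
    have := ofFrames_comp_perm (σ := σ) (X'.comp (perm ρ⁻¹)) Y' 1 ρ⁻¹
    rw [inv_inv, one_mul, comp_perm_comp_perm, comp_perm_comp_perm, mul_one, inv_mul_cancel,
      perm_one, comp_one] at this
    exact this.symm
  · rintro ⟨X', Y', h1, h2, π, rfl⟩
    have hX' := isFrame_comp_perm (isFrame_of_upper_eq e hX h1) π
    have hY' := isFrame_of_lower_eq e hY h2
    refine ⟨(ofFrames_mem_D hX' hY').1, (greenH_bar_iff e hX hX' hY hY').2 ⟨⟨π, ?_⟩, 1, ?_⟩⟩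
    · rw [← comp_assoc, h1]
    · rw [h2, perm_one, comp_one]

theorem ncard_greenH_classes {X : Brauer m q} {Y : Brauer n q} (hX : IsFrame (σ.comp X))
    (hY : IsFrame (σ.star.comp Y)) :
    ({C | C ∈ (greenH (Sandwich σ)).classes ∧
        C ⊆ hatClass e (greenH (Brauer r r)) (ofFrames σ X Y)}.ncard : ℚ) =
      ((predDoubleFactorial (m + q) : ℚ) * predDoubleFactorial (n + q)) /
        (predDoubleFactorial (r + q) : ℚ) ^ 2 := by
  rw [pow_two, mul_div_mul_comm, ← card_fibre (isFrame_tau_comp_star e) (((σ.tau e).comp σ).comp X),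
    ← card_fibre (isFrame_tau_star σ e) ((σ.tau e).comp Y), ← Nat.cast_mul, ← Nat.card_prod]
  congr 1
  refine ncard_classes_of_bijective _ _ (fun V => ofFrames σ V.1.1 V.2.1) ?_ ?_ ?_
  · rintro ⟨⟨X', h1⟩, ⟨Y', h2⟩⟩ β hβ
    have hX' := isFrame_of_upper_eq e hX h1
    have hY' := isFrame_of_lower_eq e hY h2
    have : β ∈ classOf (greenH (Sandwich σ)) (ofFrames σ X' Y') := (greenH _).symm' hβ
    rw [classOf_greenH hX' hY'] at this
    obtain ⟨π, rfl⟩ := this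
    exact (mem_hatClass_greenH_iff e hX hY _).2 ⟨X', Y', h1, h2, π, rfl⟩
  · intro β hβ
    obtain ⟨X', Y', h1, h2, π, rfl⟩ := (mem_hatClass_greenH_iff e hX hY β).1 hβ
    refine ⟨(⟨X', h1⟩, ⟨Y', h2⟩), (greenH _).symm' ?_⟩
    change _ ∈ classOf (greenH (Sandwich σ)) (ofFrames σ X' Y')
    rw [classOf_greenH (isFrame_of_upper_eq e hX h1) (isFrame_of_lower_eq e hY h2)]
    exact ⟨π, rfl⟩
  · rintro ⟨⟨X₁, h1⟩, ⟨Y₁, k1⟩⟩ ⟨⟨X₂, h2⟩, ⟨Y₂, k2⟩⟩ h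
    obtain ⟨⟨π, hπ⟩, ρ, hρ⟩ := (greenH_ofFrames_iff (isFrame_of_upper_eq e hX h1)
      (isFrame_of_upper_eq e hX h2) (isFrame_of_lower_eq e hY k1)
      (isFrame_of_lower_eq e hY k2)).1 h
    have e1 := eq_of_comp_eq ((isFrame_upper_iff e).2 hX) h1 h2 hπ
    have e2 := eq_of_comp_eq ((isFrame_lower_iff e).2 hY) k1 k2 hρ
    subst e1 e2
    rfl

/-! #### Group classes and rectangular groups -/

/-- Y* τ* τ σ X = Y* σ σ* σ X = Y* σ X. Thus the middle factor that decides whether the H-class is a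
group depends only on τσX and τY. -/
theorem star_comp_bar (X : Brauer m q) (Y : Brauer n q) :
    ((σ.tau e).comp Y).star.comp (((σ.tau e).comp σ).comp X) = Y.star.comp (σ.comp X) := by
  rw [star_comp]
  simp only [comp_assoc]
  rw [← comp_assoc (σ.tau e).star, tau_star_comp, comp_assoc, ← comp_assoc σ.star,
    ← comp_assoc σ (σ.star.comp σ), comp_star_comp]

theorem isGroupSubset_bar_iff {X : Brauer m q} {Y : Brauer n q} (hX : IsFrame (σ.comp X))
    (hY : IsFrame (σ.star.comp Y)) :
    IsGroupSubset (classOf (greenH (Sandwich σ)) (ofFrames σ X Y)) ↔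
      IsGroupSubset (classOf (greenH (Brauer r r)) (bar e (ofFrames σ X Y))) := by
  rw [isGroupSubset_iff hX hY, greenH_eq, isGroupSubset_eq, bar_ofFrames, ← star_comp_bar e X Y]
  refine Iff.symm (Iff.trans (isGroupSubset_iff ?_ ?_) ?_)
  · rwa [one_comp, isFrame_upper_iff]
  · rwa [Brauer.star_one, one_comp, isFrame_lower_iff]
  · rw [one_comp]

theorem isRectangularGroup_hatClass {X : Brauer m q} {Y : Brauer n q} (hX : IsFrame (σ.comp X))
    (hY : IsFrame (σ.star.comp Y)) (hg : IsFrame (Y.star.comp (σ.comp X))) :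
    IsRectangularGroup (hatClass e (greenH (Brauer r r)) (ofFrames σ X Y))
      (Nat.card {X' : Brauer m q // ((σ.tau e).comp σ).comp X' = ((σ.tau e).comp σ).comp X})
      (Nat.card {Y' : Brauer n q // (σ.tau e).comp Y' = (σ.tau e).comp Y})
      (Equiv.Perm (Fin q)) := by
  obtain ⟨g, hg⟩ := hg.exists_perm
  let a := (Finite.equivFin
    {X' : Brauer m q // ((σ.tau e).comp σ).comp X' = ((σ.tau e).comp σ).comp X}).symm
  let b := (Finite.equivFin {Y' : Brauer n q // (σ.tau e).comp Y' = (σ.tau e).comp Y}).symm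
  -- By `star_comp_bar` the middle factor is constant over both fibres. Hence a product keeps the
  -- left fibre coordinate of its first factor and the right one of its second, and the shift by g⁻¹
  -- makes the permutations multiply.
  have hab : ∀ u v, (b v).1.star.comp (σ.comp (a u).1) = perm g := by
    intro u v
    rw [← star_comp_bar e, (a u).2, (b v).2, star_comp_bar, hg]
  refine ⟨⟨fun x => ofFrames σ ((a x.1.1.val).1.comp (perm (x.2 * g⁻¹))) (b x.1.2.val).1, ?_⟩,
    ?_, ?_⟩
  · rintro ⟨⟨u, v⟩, π⟩ ⟨⟨u', v'⟩, ρ⟩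
    exact (ofFrames_comp_perm_mul (hab u'.val v.val) π ρ).symm
  · rintro ⟨⟨⟨u⟩, ⟨v⟩⟩, π⟩ ⟨⟨⟨u'⟩, ⟨v'⟩⟩, ρ⟩ h
    change ofFrames σ ((a u).1.comp (perm (π * g⁻¹))) (b v).1 =
      ofFrames σ ((a u').1.comp (perm (ρ * g⁻¹))) (b v').1 at h
    have hu := isFrame_of_comp (isFrame_of_upper_eq e hX (a u).2)
    have hu' := isFrame_of_comp (isFrame_of_upper_eq e hX (a u').2)
    have hv' := isFrame_of_comp (isFrame_of_lower_eq e hY (b v').2)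
    obtain ⟨θ, h1, h2⟩ := (ofFrames_eq_iff (hu.comp_perm _) (hu'.comp_perm _) hv').1 h
    have e2 := eq_of_comp_eq ((isFrame_lower_iff e).2 hY) (b v).2 (b v').2 h2
    have h3 : (a u').1 = (a u).1.comp (perm (π * g⁻¹ * θ * (ρ * g⁻¹)⁻¹)) := by
      rw [← comp_perm_comp_perm, ← comp_perm_comp_perm, ← h1, comp_perm_comp_perm,
        mul_inv_cancel, perm_one, comp_one]
    have e1 := eq_of_comp_eq ((isFrame_upper_iff e).2 hX) (a u).2 (a u').2 h3
    have e1' : u = u' := a.injective (Subtype.ext e1)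
    have e2' : v = v' := b.injective (Subtype.ext e2)
    subst e1' e2'
    have e3 := mul_right_cancel (ofFrames_comp_perm_injective hu hv' h)
    rw [e3]
  · ext β
    rw [mem_hatClass_greenH_iff e hX hY]
    constructor
    · rintro ⟨⟨⟨u, v⟩, π⟩, rfl⟩
      exact ⟨_, _, (a u.val).2, (b v.val).2, π * g⁻¹, rfl⟩
    · rintro ⟨X', Y', h1, h2, π, rfl⟩
      refine ⟨((⟨a.symm ⟨X', h1⟩⟩, ⟨b.symm ⟨Y', h2⟩⟩), π * g), ?_⟩
      change ofFrames σ ((a (a.symm ⟨X', h1⟩)).1.comp (perm (π * g * g⁻¹)))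
        (b (b.symm ⟨Y', h2⟩)).1 = _
      rw [a.apply_symm_apply, b.apply_symm_apply, mul_inv_cancel_right]

end Sandwich

/-! ### The theorem. -/

theorem mainTheorem4 {m n r q : ℕ} (σ : Brauer n m) (hr : σ.rank = r)
    (e : Fin r ≃ Diagram.transversals σ.1) (hq : q ≤ r) (hqr : q ≡ r [MOD 2]) :
    -- `D_q^σ` is a `D`-class of the sandwich semigroup
    Sandwich.D σ q ∈ (greenD (Sandwich σ)).classes ∧
    -- the classes of the relation induced by `R`
    ({X | X ∈ Sandwich.hatClasses e (greenR (Brauer r r)) ∧ X ⊆ Sandwich.D σ q}.ncard =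
        r.choose q * predDoubleFactorial (r - q) ∧
      ∀ α ∈ Sandwich.D σ q,
        Sandwich.hatClass e (greenR (Brauer r r)) α ⊆ Sandwich.D σ q ∧
        ({Y | Y ∈ (greenR (Sandwich σ)).classes ∧
            Y ⊆ Sandwich.hatClass e (greenR (Brauer r r)) α}.ncard : ℚ) =
          (predDoubleFactorial (m + q) : ℚ) / predDoubleFactorial (r + q)) ∧
    -- the classes of the relation induced by `L`
    ({X | X ∈ Sandwich.hatClasses e (greenL (Brauer r r)) ∧ X ⊆ Sandwich.D σ q}.ncard =
        r.choose q * predDoubleFactorial (r - q) ∧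
      ∀ α ∈ Sandwich.D σ q,
        Sandwich.hatClass e (greenL (Brauer r r)) α ⊆ Sandwich.D σ q ∧
        ({Y | Y ∈ (greenL (Sandwich σ)).classes ∧
            Y ⊆ Sandwich.hatClass e (greenL (Brauer r r)) α}.ncard : ℚ) =
          (predDoubleFactorial (n + q) : ℚ) / predDoubleFactorial (r + q)) ∧
    -- the classes of the relation induced by `H`
    ({X | X ∈ Sandwich.hatClasses e (greenH (Brauer r r)) ∧ X ⊆ Sandwich.D σ q}.ncard =
        r.choose q ^ 2 * predDoubleFactorial (r - q) ^ 2 ∧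
      ∀ α ∈ Sandwich.D σ q,
        Sandwich.hatClass e (greenH (Brauer r r)) α ⊆ Sandwich.D σ q ∧
        ({Y | Y ∈ (greenH (Sandwich σ)).classes ∧
            Y ⊆ Sandwich.hatClass e (greenH (Brauer r r)) α}.ncard : ℚ) =
          ((predDoubleFactorial (m + q) : ℚ) * predDoubleFactorial (n + q)) /
            (predDoubleFactorial (r + q) : ℚ) ^ 2) ∧
    -- the `H`-classes of the sandwich semigroup contained in `D_q^σ`
    (∀ α ∈ Sandwich.D σ q,
      classOf (greenH (Sandwich σ)) α ⊆ Sandwich.D σ q ∧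
      (classOf (greenH (Sandwich σ)) α).ncard = q.factorial ∧
      (IsGroupSubset (classOf (greenH (Sandwich σ)) α) →
        IsSubsetIsomorphicTo (classOf (greenH (Sandwich σ)) α) (Equiv.Perm (Fin q)))) ∧
    -- group `H`-classes and rectangular groups
    (∀ α ∈ Sandwich.D σ q,
      classOf (greenH (Brauer r r)) (Sandwich.bar e α) ⊆ {β | β.rank = q} ∧
      (IsGroupSubset (classOf (greenH (Sandwich σ)) α) ↔
        IsGroupSubset (classOf (greenH (Brauer r r)) (Sandwich.bar e α))) ∧
      (IsGroupSubset (classOf (greenH (Sandwich σ)) α) →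
        ∃ ρ l : ℕ,
          (ρ : ℚ) = (predDoubleFactorial (m + q) : ℚ) / predDoubleFactorial (r + q) ∧
          (l : ℚ) = (predDoubleFactorial (n + q) : ℚ) / predDoubleFactorial (r + q) ∧
          IsRectangularGroup (Sandwich.hatClass e (greenH (Brauer r r)) α) ρ l
            (Equiv.Perm (Fin q)))) := by
  obtain ⟨Z₀, hZ₀⟩ := Brauer.exists_isFrame hq hqr
  refine ⟨Sandwich.D_mem_classes (Sandwich.isFrame_upper_lift e hZ₀)
      (Sandwich.isFrame_lower_lift e hZ₀),
    ⟨Sandwich.ncard_hatClasses_greenR e hq hqr, fun α hα => ?_⟩,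
    ⟨Sandwich.ncard_hatClasses_greenL e hq hqr, fun α hα => ?_⟩,
    ⟨Sandwich.ncard_hatClasses_greenH e hq hqr, fun α hα => ?_⟩, fun α hα => ?_, fun α hα => ?_⟩
  all_goals obtain ⟨X, Y, hX, hY, rfl⟩ := Sandwich.mem_D_iff.1 hα
  · exact ⟨Sandwich.hatClass_greenR_subset e hα, Sandwich.ncard_greenR_classes e hX hY⟩
  · exact ⟨Sandwich.hatClass_greenL_subset e hα, Sandwich.ncard_greenL_classes e hX hY⟩
  · exact ⟨Sandwich.hatClass_greenH_subset e hα, Sandwich.ncard_greenH_classes e hX hY⟩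
  · exact ⟨fun β hβ => Sandwich.mem_D_of_greenH hα hβ, Sandwich.ncard_classOf_greenH hX hY,
      fun h => Sandwich.isSubsetIsomorphicTo_perm hX hY
        (Sandwich.isFrame_of_isGroupSubset hX hY h)⟩
  · refine ⟨fun β hβ => ?_, Sandwich.isGroupSubset_bar_iff e hX hY, fun h => ?_⟩
    · rw [Brauer.greenH_eq] at hβ
      exact (Sandwich.mem_D_of_greenH (Sandwich.bar_mem_D e hα) hβ).2
    -- The dimensions are the sizes of the two fibres, so the rational quotients are natural
    -- numbers.
    · exact ⟨_, _, Brauer.card_fibre (Sandwich.isFrame_tau_comp_star e) _,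
        Brauer.card_fibre (Brauer.isFrame_tau_star σ e) _,
        Sandwich.isRectangularGroup_hatClass e hX hY
          (Sandwich.isFrame_of_isGroupSubset hX hY h)⟩
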